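/- Let $n\ge 1$, $p>1$, $q\in(p-1,\infty)$. For $1<s<\infty$ an $A_s$ weight is a nonnegative function $w\in L^1_{\rm loc}(\mathbb R^n)$ with $$[w]_s:=\sup_B\Big(\frac1{|B|}\int_B w\,dx\Big)\Big(\frac1{|B|}\int_B w^{-\frac1{s-1}}\,dx\Big)^{s-1}<\infty ,$$ the supremum being over all balls $B\subset\mathbb R^n$. For every function $C:\mathbb R\to(0,\infty)$ there is a function $C':\mathbb R\to(0,\infty)$, depending only on $n,p,q$ and $C$, such that the following holds. Let $\Omega\subset\mathbb R^n$ be a bounded domain and let $\mathcal A:\mathbb R^n\times\mathbb R^n\to\mathbb R^n$ be a Carathéodory map ($\mathcal A(x,\xi)$ is measurable in $x$ for every $\xi$ and continuous in $\xi$ for a.e. $x$) such that, for a.e. $x$, $\mathcal A(x,0)=0$, $\mathcal A(x,\cdot)$ is continuously differentiable on $\mathbb R^n\setminus\{0\}$, and $$\langle\mathcal A(x,\xi)-\mathcal A(x,\eta),\xi-\eta\rangle\ge\Lambda_0(|\xi|^2+|\eta|^2)^{\frac{p-2}2}|\xi-\eta|^2,\qquad |\mathcal A(x,\xi)-\mathcal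 A(x,\eta)|\le\Lambda_1|\xi-\eta|(|\xi|^2+|\eta|^2)^{\frac{p-2}2}$$ for all $(\xi,\eta)\ne(0,0)$, where $\Lambda_0,\Lambda_1>0$. Let $\mathbf f\in L^p(\Omega,\mathbb R^n)$ and let $u\in W^{1,p}_0(\Omega)$ be a weak solution of $$\operatorname{div}\mathcal A(x,\nabla u)=\operatorname{div}|\mathbf f|^{p-2}\mathbf f\ \text{ in }\Omega,\qquad u=0\ \text{ on }\partial\Omega .$$ Suppose that $$\int_\Omega|\nabla u|^p\,v\,dx\le C\big([v]_{\frac p{p-1}}\big)\int_\Omega|\mathbf f|^p\,v\,dx\qquad\text{for all weights } v\in A_{\frac p{p-1}} .$$ Then $$\int_\Omega|\nabla u|^q\,w\,dx\le C'\big([w]_{\frac q{p-1}}\big)\int_\Omega|\mathbf f|^q\,w\,dx\qquad\text{for all weights } w\in A_{\frac q{p-1}} ,$$ where either integral may be $+\infty$. -/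

import Mathlib

open MeasureTheory Set Metric
open scoped ENNReal ContDiff

noncomputable section

/-- The Muckenhoupt `A_s` constant of `w` on `ℝⁿ` (`1 < s < ∞`), the supremum over all balls `B` of
`(⨍_B w) (⨍_B w ^ (-1/(s-1))) ^ (s-1)`, as an extended nonnegative number. Powers are taken
in `[0,∞]`, so that `0 ^ (-1/(s-1)) = ∞`. -/
def apConst {n : ℕ} (s : ℝ) (w : EuclideanSpace ℝ (Fin n) → ℝ) : ℝ≥0∞ :=
  ⨆ (x : EuclideanSpace ℝ (Fin n)) (r : ℝ) (_ : 0 < r),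
    (⨍⁻ y in ball x r, ENNReal.ofReal (w y) ∂volume) *
      (⨍⁻ y in ball x r, ENNReal.ofReal (w y) ^ (-1 / (s - 1)) ∂volume) ^ (s - 1)

/-- `w` is an `A_s` weight: nonnegative, locally integrable, with finite `A_s` constant. -/
structure IsApWeight {n : ℕ} (s : ℝ) (w : EuclideanSpace ℝ (Fin n) → ℝ) : Prop where
  nonneg : ∀ x, 0 ≤ w x
  locallyIntegrable : LocallyIntegrable w
  apConst_lt_top : apConst s w < ⊤

/-- `φ ∈ C_c^∞(Ω)`, real valued. -/
structure IsTestFun {n : ℕ} (Ω : Set (EuclideanSpace ℝ (Fin n)))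
    (φ : EuclideanSpace ℝ (Fin n) → ℝ) : Prop where
  contDiff : ContDiff ℝ ∞ φ
  hasCompactSupport : HasCompactSupport φ
  tsupport_subset : tsupport φ ⊆ Ω

/-- `u ∈ W^{1,p}(Ω)` with weak gradient `G`: both are in `L^p(Ω)` and
`∫_Ω u ∇φ = - ∫_Ω φ G` for all `φ ∈ C_c^∞(Ω)`. -/
structure MemSobolevW1 {n : ℕ} (p : ℝ) (Ω : Set (EuclideanSpace ℝ (Fin n)))
    (u : EuclideanSpace ℝ (Fin n) → ℝ)
    (G : EuclideanSpace ℝ (Fin n) → EuclideanSpace ℝ (Fin n)) : Prop where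
  memLp : MemLp u (ENNReal.ofReal p) (volume.restrict Ω)
  memLp_grad : MemLp G (ENNReal.ofReal p) (volume.restrict Ω)
  weakGrad : ∀ φ, IsTestFun Ω φ →
    ∫ x in Ω, u x • gradient φ x = - ∫ x in Ω, φ x • G x

/-- `u ∈ W_0^{1,p}(Ω)` with weak gradient `G`: `u` lies in the closure of `C_c^∞(Ω)` in
`W^{1,p}(Ω)`. -/
structure MemSobolevW10 {n : ℕ} (p : ℝ) (Ω : Set (EuclideanSpace ℝ (Fin n)))
    (u : EuclideanSpace ℝ (Fin n) → ℝ)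
    (G : EuclideanSpace ℝ (Fin n) → EuclideanSpace ℝ (Fin n)) : Prop
    extends MemSobolevW1 p Ω u G where
  approx : ∀ ε : ℝ≥0∞, 0 < ε → ∃ φ, IsTestFun Ω φ ∧
    eLpNorm (fun x => u x - φ x) (ENNReal.ofReal p) (volume.restrict Ω) < ε ∧
    eLpNorm (fun x => G x - gradient φ x) (ENNReal.ofReal p) (volume.restrict Ω) < ε

/-- The structure conditions on the nonlinearity `𝒜 : ℝⁿ × ℝⁿ → ℝⁿ`: a Carathéodory map,
vanishing at `ξ = 0`, continuously differentiable in `ξ ≠ 0`, with the monotonicity and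
Lipschitz type conditions of order `p` with constants `Λ₀, Λ₁ > 0`. -/
structure IsPLaplaceType {n : ℕ} (p Λ₀ Λ₁ : ℝ)
    (A : EuclideanSpace ℝ (Fin n) → EuclideanSpace ℝ (Fin n) → EuclideanSpace ℝ (Fin n)) :
    Prop where
  pos_lower : 0 < Λ₀
  pos_upper : 0 < Λ₁
  aemeasurable : ∀ ξ, AEMeasurable (fun x => A x ξ)
  continuous : ∀ᵐ x, Continuous (A x)
  map_zero : ∀ᵐ x, A x 0 = 0
  contDiffOn : ∀ᵐ x, ContDiffOn ℝ 1 (A x) {0}ᶜ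
  monotone : ∀ᵐ x, ∀ ξ η, (ξ, η) ≠ (0, 0) →
    Λ₀ * (‖ξ‖ ^ 2 + ‖η‖ ^ 2) ^ ((p - 2) / 2) * ‖ξ - η‖ ^ 2 ≤ inner ℝ (A x ξ - A x η) (ξ - η)
  lipschitz : ∀ᵐ x, ∀ ξ η, (ξ, η) ≠ (0, 0) →
    ‖A x ξ - A x η‖ ≤ Λ₁ * ‖ξ - η‖ * (‖ξ‖ ^ 2 + ‖η‖ ^ 2) ^ ((p - 2) / 2)

/-- `u ∈ W_0^{1,p}(Ω)`, with weak gradient `G`, is a weak solution of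
`div 𝒜(x, ∇u) = div |f|^{p-2} f` in `Ω`, `u = 0` on `∂Ω`. -/
structure IsWeakSolution {n : ℕ} (p : ℝ) (Ω : Set (EuclideanSpace ℝ (Fin n)))
    (A : EuclideanSpace ℝ (Fin n) → EuclideanSpace ℝ (Fin n) → EuclideanSpace ℝ (Fin n))
    (f : EuclideanSpace ℝ (Fin n) → EuclideanSpace ℝ (Fin n))
    (u : EuclideanSpace ℝ (Fin n) → ℝ)
    (G : EuclideanSpace ℝ (Fin n) → EuclideanSpace ℝ (Fin n)) : Prop where
  mem : MemSobolevW10 p Ω u G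
  weak_eq : ∀ φ, IsTestFun Ω φ →
    ∫ x in Ω, inner ℝ (A x (G x)) (gradient φ x) =
      ∫ x in Ω, inner ℝ (‖f x‖ ^ (p - 2) • f x) (gradient φ x)

end

/-! This is Rubio de Francia extrapolation for the pair `F = |∇u|^(p-1)`, `G = |f|^(p-1)`, both
extended by zero outside `Ω`. With `p₀ = p/(p-1)` and `s = q/(p-1)` the assumed estimate is an
`L^{p₀}(v)` bound of `F` by `G` for all `v ∈ A_{p₀}`, and the claim is the `L^s(w)` bound for `w ∈
A_s`.

Fix `w` and let `s' = s/(s-1)`. The maximal operator is bounded on `L^s(w)` and on the dual space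
`L^{s'}(w^(-1/(s-1)))` (`exists_ballMax_bound`), so its iteration series gives `A_1` majorants `A ≥
G` and `B ≥ F^(s-1) w` at the cost of a factor 2 in each pairing
(`lintegral_rubioDeFrancia_mul_le`). Then `V = A^(1-p₀) B` is an `A_{p₀}` weight with controlled
constant (`bound_of_factorization`), and `∫ F^s w ≤ ∫ F B ≤ (∫ F^{p₀} V)^(1/p₀) (∫ A B)^(1-1/p₀)`.
The assumed estimate and `G ≤ A` bound `∫ F^{p₀} V` by a multiple of `∫ G B`. Hence all is at most a
constant times `(∫ F^s w)^(1/s') (∫ G^s w)^(1/s)`, and division by the first factor ends the proof.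
The cases `s < p₀` and `s > p₀` need no separation.

Two points need care. The function `C` is arbitrary, not monotone, so an upper bound `κ` for the
constant of `V` does not control `C`. Instead, `V` is multiplied by a constant on a ball outside `Ω`
until its constant equals `κ` exactly (`exists_isApWeight_apConst_eq`); integrals over `Ω` do not
see the change. The division needs `∫ F^s w < ∞`, which is obtained by truncating `F`. -/

/-- Uncentred maximal function of `g` over balls, with respect to the measure `μ`. -/
noncomputable def ballMax {n : ℕ} (μ : Measure (EuclideanSpace ℝ (Fin n))) (g : EuclideanSpace ℝ (Fin n) → ℝ≥0∞)
    (x : EuclideanSpace ℝ (Fin n)) : ℝ≥0∞ :=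
  ⨆ (y : EuclideanSpace ℝ (Fin n)) (r : ℝ) (_ : x ∈ ball y r), (∫⁻ z in ball y r, g z ∂μ) / μ (ball y r)

/-! ### Weak type bounds for the maximal function of a doubling measure. -/

section BallMax

variable {n : ℕ} {μ : Measure (EuclideanSpace ℝ (Fin n))} {g h : EuclideanSpace ℝ (Fin n) → ℝ≥0∞}

lemma le_ballMax {x y : EuclideanSpace ℝ (Fin n)} {r : ℝ} (hx : x ∈ ball y r) :
    (∫⁻ z in ball y r, g z ∂μ) / μ (ball y r) ≤ ballMax μ g x :=
  le_iSup₂_of_le y r (le_iSup_of_le hx le_rfl)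

lemma ballMax_le {x : EuclideanSpace ℝ (Fin n)} {b : ℝ≥0∞}
    (H : ∀ y r, x ∈ ball y r → (∫⁻ z in ball y r, g z ∂μ) / μ (ball y r) ≤ b) :
    ballMax μ g x ≤ b :=
  iSup₂_le fun y r => iSup_le fun hx => H y r hx

lemma lt_ballMax_iff {x : EuclideanSpace ℝ (Fin n)} {t : ℝ≥0∞} :
    t < ballMax μ g x ↔
      ∃ y r, x ∈ ball y r ∧ t < (∫⁻ z in ball y r, g z ∂μ) / μ (ball y r) := by
  simp only [ballMax, lt_iSup_iff, exists_prop]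

/-- Superlevel sets are open: a ball that witnesses the value at one point witnesses it at all its
points. No measurability of `g` is needed. -/
lemma measurable_ballMax : Measurable (ballMax μ g) := by
  refine LowerSemicontinuous.measurable ?_
  rw [lowerSemicontinuous_iff_isOpen_preimage]
  intro t
  rw [Metric.isOpen_iff]
  intro x hx
  obtain ⟨y, r, hxy, ht⟩ := lt_ballMax_iff.1 hx
  obtain ⟨ε, hε, hb⟩ := Metric.isOpen_iff.1 isOpen_ball x hxy
  exact ⟨ε, hε, fun z hz => lt_ballMax_iff.2 ⟨y, r, hb hz, ht⟩⟩

lemma ballMax_const_mul (hg : Measurable g) (c : ℝ≥0∞) (x) :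
    ballMax μ (fun y => c * g y) x = c * ballMax μ g x := by
  simp only [ballMax, ENNReal.mul_iSup, lintegral_const_mul c hg, mul_div_assoc]

lemma ballMax_tsum_le {f : ℕ → EuclideanSpace ℝ (Fin n) → ℝ≥0∞} (hf : ∀ k, Measurable (f k)) (x) :
    ballMax μ (fun y => ∑' k, f k y) x ≤ ∑' k, ballMax μ (f k) x := by
  refine ballMax_le fun y r hx => ?_
  rw [lintegral_tsum fun k => (hf k).aemeasurable, div_eq_mul_inv, ← ENNReal.tsum_mul_right]
  exact ENNReal.tsum_le_tsum fun k => le_ballMax (μ := μ) (g := f k) hx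

/-- Vitali covering: disjoint balls are selected whose fivefold enlargements cover the union, and
doubling pays for the enlargement. Vitali needs the radius bound `R`, which does not enter the
estimate. -/
lemma meas_iUnion_balls_le {D t : ℝ≥0∞} (R : ℝ)
    (hD : ∀ x r, 0 < r → μ (ball x (5 * r)) ≤ D * μ (ball x r))
    {T : Set (EuclideanSpace ℝ (Fin n) × ℝ)}
    (hT : ∀ a ∈ T, 0 < a.2 ∧ a.2 ≤ R ∧ t * μ (ball a.1 a.2) ≤ ∫⁻ z in ball a.1 a.2, g z ∂μ) :
    t * μ (⋃ a ∈ T, ball a.1 a.2) ≤ D * ∫⁻ z, g z ∂μ := by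
  -- Any factor above 3 is allowed. The choice 4 leaves room to pass from closed balls to the open
  -- balls of radius `5 * a.2`.
  obtain ⟨u, huT, hdis, hcov⟩ := Vitali.exists_disjoint_subfamily_covering_enlargement_closedBall
    T Prod.fst Prod.snd R (fun a ha => (hT a ha).2.1) 4 (by norm_num)
  have hdis' : u.PairwiseDisjoint fun a => ball a.1 a.2 :=
    hdis.mono fun a => ball_subset_closedBall
  have hcount : u.Countable := hdis'.countable_of_isOpen (fun _ _ => isOpen_ball)
    fun a ha => nonempty_ball.2 (hT a (huT ha)).1
  have hsub : (⋃ a ∈ T, ball a.1 a.2) ⊆ ⋃ a ∈ u, ball a.1 (5 * a.2) := by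
    refine iUnion₂_subset fun a ha => ?_
    obtain ⟨b, hb, hab⟩ := hcov a ha
    have hb0 := (hT b (huT hb)).1
    exact (ball_subset_closedBall.trans (hab.trans (closedBall_subset_ball (by linarith)))).trans
      (subset_biUnion_of_mem (u := fun a : EuclideanSpace ℝ (Fin n) × ℝ => ball a.1 (5 * a.2)) hb)
  have : Countable u := hcount.to_subtype
  calc t * μ (⋃ a ∈ T, ball a.1 a.2) ≤ t * ∑' a : u, μ (ball a.1.1 (5 * a.1.2)) := by
        gcongr
        exact (measure_mono hsub).trans (measure_biUnion_le μ hcount _)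
    _ = ∑' a : u, t * μ (ball a.1.1 (5 * a.1.2)) := ENNReal.tsum_mul_left.symm
    _ ≤ ∑' a : u, D * ∫⁻ z in ball a.1.1 a.1.2, g z ∂μ := by
        refine ENNReal.tsum_le_tsum fun a => ?_
        obtain ⟨h0, -, h1⟩ := hT a.1 (huT a.2)
        calc t * μ (ball a.1.1 (5 * a.1.2)) ≤ t * (D * μ (ball a.1.1 a.1.2)) := by
              gcongr; exact hD _ _ h0
          _ = D * (t * μ (ball a.1.1 a.1.2)) := by ring
          _ ≤ _ := by gcongr
    _ = D * ∑' a : u, ∫⁻ z in ball a.1.1 a.1.2, g z ∂μ := ENNReal.tsum_mul_left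
    _ = D * ∫⁻ z in ⋃ a ∈ u, ball a.1 a.2, g z ∂μ := by
        rw [lintegral_biUnion hcount (fun _ _ => measurableSet_ball) hdis']
    _ ≤ _ := by gcongr; exact Measure.restrict_le_self

lemma ballMax_weak_type {D : ℝ≥0∞}
    (hD : ∀ x r, 0 < r → μ (ball x (5 * r)) ≤ D * μ (ball x r)) (t : ℝ≥0∞) :
    t * μ {x | t < ballMax μ g x} ≤ D * ∫⁻ z, g z ∂μ := by
  let T : ℕ → Set (EuclideanSpace ℝ (Fin n) × ℝ) := fun k =>
    {a | 0 < a.2 ∧ a.2 ≤ k ∧ t * μ (ball a.1 a.2) ≤ ∫⁻ z in ball a.1 a.2, g z ∂μ}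
  have hsub : {x | t < ballMax μ g x} ⊆ ⋃ k, ⋃ a ∈ T k, ball a.1 a.2 := by
    intro x hx
    obtain ⟨y, r, hxy, ht⟩ := lt_ballMax_iff.1 hx
    obtain ⟨k, hk⟩ := exists_nat_ge r
    simp only [mem_iUnion]
    exact ⟨k, (y, r), ⟨pos_of_mem_ball hxy, hk, ENNReal.mul_le_of_le_div ht.le⟩, hxy⟩
  have hmono : Monotone fun k => ⋃ a ∈ T k, ball a.1 a.2 := by
    intro k l hkl
    refine biUnion_subset_biUnion_left fun a ha => ⟨ha.1, ha.2.1.trans ?_, ha.2.2⟩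
    exact_mod_cast hkl
  calc t * μ {x | t < ballMax μ g x} ≤ t * μ (⋃ k, ⋃ a ∈ T k, ball a.1 a.2) := by gcongr
    _ = ⨆ k, t * μ (⋃ a ∈ T k, ball a.1 a.2) := by
        rw [hmono.measure_iUnion, ENNReal.mul_iSup]
    _ ≤ _ := iSup_le fun k => meas_iUnion_balls_le k hD fun a ha => ha

/-- The part of `g` that is at most `t / 2` adds at most `t / 2` to the maximal function, so only
the large part counts at level `t`. This localization is what makes the integration over `t`
converge in the strong type bound. -/
lemma ballMax_weak_type' {D : ℝ≥0∞}
    (hD : ∀ x r, 0 < r → μ (ball x (5 * r)) ≤ D * μ (ball x r)) (t : ℝ≥0∞) :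
    t * μ {x | t < ballMax μ g x} ≤
      2 * D * ∫⁻ z, {z | t < 2 * g z}.indicator g z ∂μ := by
  set g₁ := {z | t < 2 * g z}.indicator g with hg₁
  have hle : ∀ x, ballMax μ g x ≤ ballMax μ g₁ x + t / 2 := by
    intro x
    refine ballMax_le fun y r hx => ?_
    have : ∫⁻ z in ball y r, g z ∂μ ≤ (∫⁻ z in ball y r, g₁ z ∂μ) + t / 2 * μ (ball y r) := by
      rw [← setLIntegral_const, ← lintegral_add_right _ measurable_const]
      refine lintegral_mono fun z => ?_
      by_cases hz : t < 2 * g z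
      · simp [hg₁, hz]
      · simp only [hg₁, indicator, mem_ofPred_eq, hz, if_false, zero_add]
        rw [ENNReal.le_div_iff_mul_le (by simp) (by simp), mul_comm]
        exact not_lt.1 hz
    calc _ ≤ ((∫⁻ z in ball y r, g₁ z ∂μ) + t / 2 * μ (ball y r)) / μ (ball y r) := by gcongr
      _ = (∫⁻ z in ball y r, g₁ z ∂μ) / μ (ball y r) + t / 2 * μ (ball y r) / μ (ball y r) :=
          ENNReal.add_div
      _ ≤ _ := by
          exact add_le_add (le_ballMax hx) (ENNReal.div_le_of_le_mul le_rfl)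
  have hsub : {x | t < ballMax μ g x} ⊆ {x | t / 2 < ballMax μ g₁ x} := by
    intro x hx
    have h1 : t < ballMax μ g₁ x + t / 2 := lt_of_lt_of_le hx (hle x)
    by_contra hcon
    have h2 : ballMax μ g₁ x ≤ t / 2 := not_lt.1 hcon
    have : ballMax μ g₁ x + t / 2 ≤ t := by
      calc _ ≤ t / 2 + t / 2 := by gcongr
        _ = t := ENNReal.add_halves t
    exact absurd h1 (not_lt.2 this)
  calc t * μ {x | t < ballMax μ g x} = 2 * (t / 2 * μ {x | t < ballMax μ g x}) := by
        rw [← mul_assoc, ENNReal.mul_div_cancel (by simp) (by simp)]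
    _ ≤ 2 * (t / 2 * μ {x | t / 2 < ballMax μ g₁ x}) := by gcongr
    _ ≤ 2 * (D * ∫⁻ z, g₁ z ∂μ) := mul_le_mul_right (ballMax_weak_type hD _) _
    _ = _ := by ring

end BallMax

/-! ### Layer cake formula and strong type bound. -/

lemma lintegral_Ioi_indicator_rpow {c : ℝ} (hc : 0 < c) (a : ℝ≥0∞) :
    ∫⁻ t in Ioi (0 : ℝ), {t | ENNReal.ofReal t < a}.indicator
      (fun t => ENNReal.ofReal (c * t ^ (c - 1))) t = a ^ c := by
  have key : ∀ b : ℝ, 0 ≤ b → ∫⁻ t in Ioi (0 : ℝ), {t | ENNReal.ofReal t < ENNReal.ofReal b}.indicator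
      (fun t => ENNReal.ofReal (c * t ^ (c - 1))) t = ENNReal.ofReal b ^ c := by
    intro b hb
    have hint : IntervalIntegrable (fun t : ℝ => c * t ^ (c - 1)) volume 0 b :=
      (intervalIntegral.intervalIntegrable_rpow' (by linarith)).const_mul c
    have hset : MeasurableSet {t : ℝ | ENNReal.ofReal t < ENNReal.ofReal b} :=
      measurableSet_lt ENNReal.measurable_ofReal measurable_const
    have hinter : {t : ℝ | ENNReal.ofReal t < ENNReal.ofReal b} ∩ Ioi 0 = Ioo 0 b := by
      ext t
      simp only [mem_inter_iff, mem_ofPred_eq, mem_Ioi, mem_Ioo]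
      constructor
      · rintro ⟨h1, h2⟩
        exact ⟨h2, (ENNReal.ofReal_lt_ofReal_iff_of_nonneg h2.le).1 h1⟩
      · rintro ⟨h1, h2⟩
        exact ⟨(ENNReal.ofReal_lt_ofReal_iff_of_nonneg h1.le).2 h2, h1⟩
    rw [lintegral_indicator hset, Measure.restrict_restrict hset, hinter,
      Measure.restrict_congr_set Ioo_ae_eq_Ioc, ← ofReal_integral_eq_lintegral_ofReal,
      ← intervalIntegral.integral_of_le hb, intervalIntegral.integral_const_mul,
      integral_rpow (Or.inl (by linarith)), ENNReal.ofReal_rpow_of_nonneg hb hc.le]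
    · congr 1
      rw [sub_add_cancel, Real.zero_rpow hc.ne']
      field_simp
      ring
    · exact hint.1
    · refine (ae_restrict_iff' measurableSet_Ioc).2 (Filter.Eventually.of_forall fun t ht => ?_)
      exact mul_nonneg hc.le (Real.rpow_nonneg ht.1.le _)
  by_cases ha : a = ⊤
  · subst ha
    rw [ENNReal.top_rpow_of_pos hc]
    refine ENNReal.eq_top_of_forall_nnreal_le fun r => ?_
    have h0 : ENNReal.ofReal ((r : ℝ) ^ c⁻¹) ^ c = r := by
      rw [ENNReal.ofReal_rpow_of_nonneg (by positivity) hc.le,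
        Real.rpow_inv_rpow r.coe_nonneg hc.ne', ENNReal.ofReal_coe_nnreal]
    rw [← h0, ← key _ (by positivity)]
    refine lintegral_mono fun t => indicator_le_indicator_of_subset (fun t ht => ?_) (by simp) t
    simp
  · rw [← ENNReal.ofReal_toReal ha]
    exact key _ ENNReal.toReal_nonneg

/-- Marcinkiewicz interpolation by hand: layer cake for the maximal function, the localized weak
type bound at each level, Tonelli, then layer cake for `2 * g` with exponent `a - 1`. The constant
sees the measure only through `D`. -/
lemma ballMax_strong_type {n : ℕ} {μ : Measure (EuclideanSpace ℝ (Fin n))} [SFinite μ]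
    {g : EuclideanSpace ℝ (Fin n) → ℝ≥0∞}
    {D : ℝ≥0∞} (hg : Measurable g) {a : ℝ} (ha : 1 < a)
    (hD : ∀ x r, 0 < r → μ (ball x (5 * r)) ≤ D * μ (ball x r)) :
    ∫⁻ x, ballMax μ g x ^ a ∂μ ≤
      2 * D * ENNReal.ofReal (a / (a - 1)) * 2 ^ (a - 1) * ∫⁻ x, g x ^ a ∂μ := by
  have ha1 : 0 < a - 1 := by linarith
  have hmeas : ∀ (f : EuclideanSpace ℝ (Fin n) → ℝ≥0∞), Measurable f → ∀ c : ℝ,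
      Measurable (fun p : EuclideanSpace ℝ (Fin n) × ℝ =>
        {t | ENNReal.ofReal t < f p.1}.indicator
        (fun t => ENNReal.ofReal (c * t ^ (c - 1))) p.2) := by
    intro f hf c
    have hset : MeasurableSet {p : EuclideanSpace ℝ (Fin n) × ℝ | ENNReal.ofReal p.2 < f p.1} :=
      measurableSet_lt (by fun_prop) (by fun_prop)
    have : Measurable (fun p : EuclideanSpace ℝ (Fin n) × ℝ =>
      ENNReal.ofReal (c * p.2 ^ (c - 1))) := by fun_prop
    exact this.indicator hset
  have hM : Measurable (ballMax μ g) := measurable_ballMax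
  have hg2 : Measurable fun x => 2 * g x := by fun_prop
  set Q : ℝ≥0∞ := 2 * D * ENNReal.ofReal (a / (a - 1)) with hQ
  calc ∫⁻ x, ballMax μ g x ^ a ∂μ
      = ∫⁻ x, (∫⁻ t in Ioi (0 : ℝ), {t | ENNReal.ofReal t < ballMax μ g x}.indicator
          (fun t => ENNReal.ofReal (a * t ^ (a - 1))) t) ∂μ := by
        simp_rw [lintegral_Ioi_indicator_rpow (by linarith : (0:ℝ) < a)]
    _ = ∫⁻ t in Ioi (0 : ℝ), ∫⁻ x, {t | ENNReal.ofReal t < ballMax μ g x}.indicator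
          (fun t => ENNReal.ofReal (a * t ^ (a - 1))) t ∂μ :=
        lintegral_lintegral_swap (hmeas _ hM a).aemeasurable
    _ ≤ ∫⁻ t in Ioi (0 : ℝ), ∫⁻ x, Q * (g x * {t | ENNReal.ofReal t < 2 * g x}.indicator
          (fun t => ENNReal.ofReal ((a - 1) * t ^ (a - 1 - 1))) t) ∂μ := by
        refine lintegral_mono_ae ((ae_restrict_iff' measurableSet_Ioi).2
          (Filter.Eventually.of_forall fun t ht => ?_))
        have ht0 : (0 : ℝ) < t := ht
        have e1 : ∫⁻ x, {t | ENNReal.ofReal t < ballMax μ g x}.indicator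
            (fun t => ENNReal.ofReal (a * t ^ (a - 1))) t ∂μ =
            ENNReal.ofReal (a * t ^ (a - 1)) * μ {x | ENNReal.ofReal t < ballMax μ g x} := by
          rw [← lintegral_indicator_const (measurableSet_lt measurable_const hM)]
          rfl
        have e2 : ∫⁻ x, Q * (g x * {t | ENNReal.ofReal t < 2 * g x}.indicator
            (fun t => ENNReal.ofReal ((a - 1) * t ^ (a - 1 - 1))) t) ∂μ =
            Q * ENNReal.ofReal ((a - 1) * t ^ (a - 1 - 1)) *
              ∫⁻ x, {x | ENNReal.ofReal t < 2 * g x}.indicator g x ∂μ := by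
          rw [← lintegral_const_mul _ (hg.indicator (measurableSet_lt measurable_const hg2))]
          refine lintegral_congr fun x => ?_
          by_cases hx : ENNReal.ofReal t < 2 * g x
          · simp only [indicator, mem_ofPred_eq, hx, if_true]; ring
          · simp [indicator, hx]
        rw [e1, e2]
        -- One factor `t` is set aside for the weak type bound; the rest is the layer cake density
        -- of exponent `a - 1`.
        have e3 : ENNReal.ofReal (a * t ^ (a - 1)) =
            ENNReal.ofReal (a / (a - 1)) * ENNReal.ofReal ((a - 1) * t ^ (a - 1 - 1)) *
              ENNReal.ofReal t := by
          rw [← ENNReal.ofReal_mul (by positivity), ← ENNReal.ofReal_mul (by positivity)]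
          congr 1
          rw [Real.rpow_sub_one ht0.ne' (a - 1)]
          field_simp
        rw [e3, hQ]
        calc _ = ENNReal.ofReal (a / (a - 1)) * ENNReal.ofReal ((a - 1) * t ^ (a - 1 - 1)) *
              (ENNReal.ofReal t * μ {x | ENNReal.ofReal t < ballMax μ g x}) := by ring
          _ ≤ ENNReal.ofReal (a / (a - 1)) * ENNReal.ofReal ((a - 1) * t ^ (a - 1 - 1)) *
              (2 * D * ∫⁻ z, {z | ENNReal.ofReal t < 2 * g z}.indicator g z ∂μ) := by
              exact mul_le_mul_right (ballMax_weak_type' hD _) _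
          _ = _ := by ring
    _ = ∫⁻ x, (∫⁻ t in Ioi (0 : ℝ), Q * (g x * {t | ENNReal.ofReal t < 2 * g x}.indicator
          (fun t => ENNReal.ofReal ((a - 1) * t ^ (a - 1 - 1))) t)) ∂μ := by
        refine (lintegral_lintegral_swap ?_).symm
        exact (((hg.comp measurable_fst).mul (hmeas _ hg2 (a - 1))).const_mul Q).aemeasurable
    _ = ∫⁻ x, Q * (g x * (2 * g x) ^ (a - 1)) ∂μ := by
        refine lintegral_congr fun x => ?_
        have hm : Measurable fun t : ℝ => {t | ENNReal.ofReal t < 2 * g x}.indicator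
            (fun t => ENNReal.ofReal ((a - 1) * t ^ (a - 1 - 1))) t :=
          (hmeas _ hg2 (a - 1)).comp (measurable_prodMk_left (x := x))
        rw [lintegral_const_mul _ (hm.const_mul _), lintegral_const_mul _ hm,
          lintegral_Ioi_indicator_rpow ha1]
    _ = Q * 2 ^ (a - 1) * ∫⁻ x, g x ^ a ∂μ := by
        rw [← lintegral_const_mul _ (hg.pow_const a)]
        refine lintegral_congr fun x => ?_
        rw [ENNReal.mul_rpow_of_nonneg _ _ ha1.le]
        have : g x * g x ^ (a - 1) = g x ^ a := by
          conv_lhs => enter [1]; rw [← ENNReal.rpow_one (g x)]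
          rw [← ENNReal.rpow_add_of_nonneg _ _ zero_le_one ha1.le]
          congr 1; ring
        rw [← this]; ring

/-! ### Muckenhoupt's maximal theorem with a constant uniform in the weight. -/

/-- A measurable weight with values in `(0, ∞)` whose `A_s` constant is at most `K`. -/
structure IsMuckenhoupt {n : ℕ} (s : ℝ) (K : ℝ≥0∞) (ϖ : EuclideanSpace ℝ (Fin n) → ℝ≥0∞) :
    Prop where
  one_lt : 1 < s
  measurable : Measurable ϖ
  ne_zero : ∀ x, ϖ x ≠ 0
  ne_top : ∀ x, ϖ x ≠ ⊤
  const_ne_top : K ≠ ⊤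
  bound : ∀ x r, 0 < r → (∫⁻ y in ball x r, ϖ y) *
    (∫⁻ y in ball x r, ϖ y ^ (-1 / (s - 1))) ^ (s - 1) ≤ K * volume (ball x r) ^ s

section Muckenhoupt

variable {n : ℕ} {s : ℝ} {K : ℝ≥0∞} {ϖ : EuclideanSpace ℝ (Fin n) → ℝ≥0∞}

lemma setLIntegral_ball_ne_zero {f : EuclideanSpace ℝ (Fin n) → ℝ≥0∞} (hf : AEMeasurable f)
    (h0 : ∀ᵐ x, f x ≠ 0) (x : EuclideanSpace ℝ (Fin n)) {r : ℝ} (hr : 0 < r) :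
    ∫⁻ y in ball x r, f y ≠ 0 := by
  rw [Ne, lintegral_eq_zero_iff' hf.restrict]
  intro h
  have h1 : ∀ᵐ y ∂(volume.restrict (ball x r)), False := by
    filter_upwards [h, ae_restrict_of_ae h0] with y hy hy'
    exact hy' hy
  rw [Filter.eventually_false_iff_eq_bot, ae_eq_bot, Measure.restrict_eq_zero] at h1
  exact (measure_ball_pos volume x hr).ne' h1

lemma volume_ball_ne_zero (x : EuclideanSpace ℝ (Fin n)) {r : ℝ} (hr : 0 < r) :
    volume (ball x r) ≠ 0 := (measure_ball_pos volume x hr).ne'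

lemma volume_ball_ne_top (x : EuclideanSpace ℝ (Fin n)) (r : ℝ) :
    volume (ball x r) ≠ ⊤ := measure_ball_lt_top.ne

namespace IsMuckenhoupt

lemma measurable_dual (h : IsMuckenhoupt s K ϖ) : Measurable fun y => ϖ y ^ (-1 / (s - 1)) :=
  h.measurable.pow_const _

/-- The `A_s` inequality raised to the power `1 / (s - 1)` is the `A_{s'}` inequality of the dual
weight. -/
lemma dual (h : IsMuckenhoupt s K ϖ) :
    IsMuckenhoupt (s / (s - 1)) (K ^ (1 / (s - 1))) (fun y => ϖ y ^ (-1 / (s - 1))) := by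
  have h1 : 0 < s - 1 := by linarith [h.one_lt]
  have hd : s / (s - 1) - 1 = 1 / (s - 1) := by field_simp; ring
  have hexp : ∀ y, (ϖ y ^ (-1 / (s - 1))) ^ (-1 / (s / (s - 1) - 1)) = ϖ y := by
    intro y
    rw [← ENNReal.rpow_mul, hd]
    have : -1 / (s - 1) * (-1 / (1 / (s - 1))) = 1 := by field_simp
    rw [this, ENNReal.rpow_one]
  refine ⟨?_, h.measurable_dual, fun x => ?_, fun x => ?_,
    ENNReal.rpow_ne_top_of_nonneg (by positivity) h.const_ne_top, fun x r hr => ?_⟩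
  · rw [lt_div_iff₀ h1]; linarith
  · simp [ENNReal.rpow_eq_zero_iff, h.ne_zero x, h.ne_top x]
  · simp [ENNReal.rpow_eq_top_iff, h.ne_zero x, h.ne_top x]
  · simp only [hexp]
    have := ENNReal.rpow_le_rpow (h.bound x r hr) (by positivity : 0 ≤ 1 / (s - 1))
    rw [ENNReal.mul_rpow_of_nonneg _ _ (by positivity), ENNReal.mul_rpow_of_nonneg _ _ (by positivity),
      ← ENNReal.rpow_mul, ← ENNReal.rpow_mul, mul_one_div_cancel h1.ne', ENNReal.rpow_one,
      mul_one_div] at this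
    rw [hd, mul_comm]
    exact this

lemma lintegral_ne_zero (h : IsMuckenhoupt s K ϖ) (x) {r : ℝ} (hr : 0 < r) :
    ∫⁻ y in ball x r, ϖ y ≠ 0 :=
  setLIntegral_ball_ne_zero h.measurable.aemeasurable (Filter.Eventually.of_forall h.ne_zero) x hr

lemma lintegral_ne_top (h : IsMuckenhoupt s K ϖ) (x) {r : ℝ} (hr : 0 < r) :
    ∫⁻ y in ball x r, ϖ y ≠ ⊤ := by
  intro ht
  have h1 : 0 < s - 1 := by linarith [h.one_lt]
  have h2 := h.bound x r hr
  have h3 := h.dual.lintegral_ne_zero x hr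
  rw [ht, ENNReal.top_mul, top_le_iff] at h2
  · refine ENNReal.mul_ne_top h.const_ne_top
      (ENNReal.rpow_ne_top_of_nonneg (by linarith) (volume_ball_ne_top x r)) h2
  · simp only [Ne, ENNReal.rpow_eq_zero_iff, h3, false_and, false_or, not_and, not_lt]
    exact fun _ => h1.le

lemma holderConjugate (h : IsMuckenhoupt s K ϖ) : s.HolderConjugate (s / (s - 1)) :=
  (Real.holderConjugate_iff_eq_conjExponent h.one_lt).2 rfl

/-- Hölder's inequality between `L^s(ϖ)` and `L^{s'}(ϖ^{-1/(s-1)})`. -/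
lemma lintegral_mul_le (h : IsMuckenhoupt s K ϖ) (ν : Measure (EuclideanSpace ℝ (Fin n)))
    {a b : EuclideanSpace ℝ (Fin n) → ℝ≥0∞} (ha : Measurable a) (hb : Measurable b) :
    ∫⁻ x, a x * b x ∂ν ≤ (∫⁻ x, a x ^ s * ϖ x ∂ν) ^ (1 / s) *
      (∫⁻ x, b x ^ (s / (s - 1)) * ϖ x ^ (-1 / (s - 1)) ∂ν) ^ (1 / (s / (s - 1))) := by
  have hs : 1 < s := h.one_lt
  have h1 : 0 < s - 1 := by linarith
  have hϖ := h.measurable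
  have := ENNReal.lintegral_mul_le_Lp_mul_Lq ν h.holderConjugate
    (f := fun x => a x * ϖ x ^ (1 / s)) (g := fun x => b x * ϖ x ^ (-(1 / s)))
    (by fun_prop) (by fun_prop)
  convert this using 2
  · funext x
    have e : ϖ x ^ (1 / s) * ϖ x ^ (-(1 / s)) = 1 := by
      rw [← ENNReal.rpow_add _ _ (h.ne_zero x) (h.ne_top x), add_neg_cancel, ENNReal.rpow_zero]
    simp only [Pi.mul_apply]
    calc a x * b x = a x * b x * (ϖ x ^ (1 / s) * ϖ x ^ (-(1 / s))) := by rw [e, mul_one]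
      _ = _ := by ring
  · congr 1
    refine lintegral_congr fun x => ?_
    rw [ENNReal.mul_rpow_of_nonneg _ _ (by linarith), ← ENNReal.rpow_mul,
      one_div_mul_cancel (by linarith), ENNReal.rpow_one]
  · congr 1
    refine lintegral_congr fun x => ?_
    rw [ENNReal.mul_rpow_of_nonneg _ _ (by positivity), ← ENNReal.rpow_mul]
    congr 2
    field_simp

/-- Hölder on the small ball `B` gives `|B|^s ≤ ϖ(B) σ(B)^(s-1)` with `σ` the dual weight. Enlarging
`σ(B)` to `σ(5B)` and multiplying by `ϖ(5B)` brings in the `A_s` inequality on `5B`. -/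
lemma doubling (h : IsMuckenhoupt s K ϖ) (x) (r : ℝ) (hr : 0 < r) :
    (volume.withDensity ϖ) (ball x (5 * r)) ≤
      (K * ENNReal.ofReal (5 ^ n) ^ s) * (volume.withDensity ϖ) (ball x r) := by
  have hs : 1 < s := h.one_lt
  have h1 : 0 < s - 1 := by linarith
  rw [withDensity_apply _ measurableSet_ball, withDensity_apply _ measurableSet_ball]
  have hH := h.lintegral_mul_le (volume.restrict (ball x r)) (a := fun _ => 1) (b := fun _ => 1)
    measurable_const measurable_const
  simp only [mul_one, ENNReal.one_rpow, one_mul, setLIntegral_const] at hH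
  have hH2 := ENNReal.rpow_le_rpow hH (by linarith : 0 ≤ s)
  rw [ENNReal.mul_rpow_of_nonneg _ _ (by linarith), ← ENNReal.rpow_mul, ← ENNReal.rpow_mul,
    one_div_mul_cancel (by linarith), ENNReal.rpow_one] at hH2
  have e : 1 / (s / (s - 1)) * s = s - 1 := by field_simp
  rw [e] at hH2
  have h5 : volume (ball x (5 * r)) = ENNReal.ofReal (5 ^ n) * volume (ball x r) := by
    rw [Measure.addHaar_ball_mul_of_pos _ _ (by norm_num : (0:ℝ) < 5), finrank_euclideanSpace_fin,
      Measure.addHaar_ball_center volume x]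
  have hb := h.bound x (5 * r) (by linarith)
  rw [h5, ENNReal.mul_rpow_of_nonneg _ _ (by linarith)] at hb
  have hm0 : volume (ball x r) ^ s ≠ 0 := by
    simp [ENNReal.rpow_eq_zero_iff, volume_ball_ne_zero x hr, volume_ball_ne_top x r]
  have hmt : volume (ball x r) ^ s ≠ ⊤ :=
    ENNReal.rpow_ne_top_of_nonneg (by linarith) (volume_ball_ne_top x r)
  have hsub : ball x r ⊆ ball x (5 * r) := ball_subset_ball (by linarith)
  rw [← ENNReal.mul_le_mul_iff_left hm0 hmt]
  calc (∫⁻ y in ball x (5 * r), ϖ y) * volume (ball x r) ^ s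
      ≤ (∫⁻ y in ball x (5 * r), ϖ y) * ((∫⁻ y in ball x r, ϖ y) *
          (∫⁻ y in ball x (5 * r), ϖ y ^ (-1 / (s - 1))) ^ (s - 1)) := by
        refine mul_le_mul_right (hH2.trans ?_) _
        gcongr
    _ = (∫⁻ y in ball x r, ϖ y) * ((∫⁻ y in ball x (5 * r), ϖ y) *
          (∫⁻ y in ball x (5 * r), ϖ y ^ (-1 / (s - 1))) ^ (s - 1)) := by ring
    _ ≤ (∫⁻ y in ball x r, ϖ y) *
        (K * (ENNReal.ofReal (5 ^ n) ^ s * volume (ball x r) ^ s)) := by gcongr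
    _ = _ := by ring

/-- Lerner's pointwise bound of the maximal function by two weighted ones. -/
lemma ballMax_rpow_le (h : IsMuckenhoupt s K ϖ) {f : EuclideanSpace ℝ (Fin n) → ℝ≥0∞}
    (hf : Measurable f) (x) :
    ballMax volume f x ^ (s - 1) ≤ K * ballMax (volume.withDensity ϖ) (fun y =>
      ballMax (volume.withDensity fun z => ϖ z ^ (-1 / (s - 1)))
        (fun z => f z / ϖ z ^ (-1 / (s - 1))) y ^ (s - 1) / ϖ y) x := by
  have hs : 1 < s := h.one_lt
  have h1 : 0 < s - 1 := by linarith
  set σ := fun z => ϖ z ^ (-1 / (s - 1)) with hσ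
  have hσd : IsMuckenhoupt _ _ σ := h.dual
  set Mσ := ballMax (volume.withDensity σ) (fun z => f z / σ z) with hMσ
  have hMm : Measurable Mσ := measurable_ballMax
  have hϖm := h.measurable
  have hσm := hσd.measurable
  rw [← ENNReal.le_rpow_inv_iff h1]
  refine ballMax_le fun y r hx => ?_
  rw [ENNReal.le_rpow_inv_iff h1]
  have hr : 0 < r := pos_of_mem_ball hx
  set B := ball y r with hB
  set I := ∫⁻ z in B, f z with hI
  set W := ∫⁻ z in B, ϖ z with hW
  set S := ∫⁻ z in B, σ z with hS
  set J := ∫⁻ z in B, Mσ z ^ (s - 1) with hJ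
  set m := volume B with hm
  have hS0 : S ≠ 0 := hσd.lintegral_ne_zero y hr
  have hSt : S ≠ ⊤ := hσd.lintegral_ne_top y hr
  have hW0 : W ≠ 0 := h.lintegral_ne_zero y hr
  have hWt : W ≠ ⊤ := h.lintegral_ne_top y hr
  have hm0 : m ≠ 0 := volume_ball_ne_zero y hr
  have hmt : m ≠ ⊤ := volume_ball_ne_top y r
  -- `B` competes in the supremum at each of its points, so `Mσ` is at least the `σ`-average of `f /
  -- σ` everywhere on `B`.
  have ha : ∀ z ∈ B, I / S ≤ Mσ z := by
    intro z hz
    have := le_ballMax (μ := volume.withDensity σ) (g := fun z => f z / σ z) hz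
    rw [withDensity_apply _ measurableSet_ball, setLIntegral_withDensity_eq_setLIntegral_mul _
      hσm (g := fun z => f z / σ z) (hf.div hσm) measurableSet_ball] at this
    convert this using 2
    refine lintegral_congr fun w => ?_
    exact (ENNReal.mul_div_cancel (hσd.ne_zero w) (hσd.ne_top w)).symm
  have hIJ : (I / S) ^ (s - 1) * m ≤ J := by
    rw [← setLIntegral_const]
    exact setLIntegral_mono (hMm.pow_const _) fun z hz =>
      ENNReal.rpow_le_rpow (ha z hz) h1.le
  have hJW : J / W ≤ ballMax (volume.withDensity ϖ) (fun y => Mσ y ^ (s - 1) / ϖ y) x := by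
    have := le_ballMax (μ := volume.withDensity ϖ) (g := fun y => Mσ y ^ (s - 1) / ϖ y) hx
    rw [withDensity_apply _ measurableSet_ball, setLIntegral_withDensity_eq_setLIntegral_mul _
      hϖm (g := fun y => Mσ y ^ (s - 1) / ϖ y) ((hMm.pow_const _).div hϖm)
      measurableSet_ball] at this
    convert this using 2
    refine lintegral_congr fun w => ?_
    exact (ENNReal.mul_div_cancel (h.ne_zero w) (h.ne_top w)).symm
  refine le_trans ?_ (mul_le_mul_right hJW K)
  have hbd : W * S ^ (s - 1) ≤ K * m ^ s := h.bound y r hr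
  have hms : m ^ s = m ^ (s - 1) * m := by
    conv_rhs => enter [2]; rw [← ENNReal.rpow_one m]
    rw [← ENNReal.rpow_add _ _ hm0 hmt, sub_add_cancel]
  have hms0 : m ^ (s - 1) ≠ 0 := by simp [ENNReal.rpow_eq_zero_iff, hm0, hmt]
  have hmst : m ^ (s - 1) ≠ ⊤ := ENNReal.rpow_ne_top_of_nonneg h1.le hmt
  rw [ENNReal.div_rpow_of_nonneg _ _ h1.le, ENNReal.div_le_iff hms0 hmst, ← mul_div_assoc,
    ENNReal.mul_comm_div, ← mul_div_assoc, ENNReal.le_div_iff_mul_le (Or.inl hW0) (Or.inl hWt),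
    ← ENNReal.mul_le_mul_iff_left hm0 hmt]
  -- The `A_s` inequality `W * S ^ (s - 1) ≤ K * m ^ s` exchanges the Lebesgue average `I / m` for
  -- the weighted averages `I / S` and `J / W`.
  calc I ^ (s - 1) * W * m = (I / S) ^ (s - 1) * m * (W * S ^ (s - 1)) := by
        have : I ^ (s - 1) = (I / S) ^ (s - 1) * S ^ (s - 1) := by
          rw [← ENNReal.mul_rpow_of_nonneg _ _ h1.le, ENNReal.div_mul_cancel hS0 hSt]
        rw [this]; ring
    _ ≤ J * (K * m ^ s) := mul_le_mul' hIJ hbd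
    _ = _ := by rw [hms]; ring

/-- Muckenhoupt's theorem, with a constant that depends on `n`, `s` and `K` only. -/
lemma lintegral_ballMax_rpow_le (h : IsMuckenhoupt s K ϖ) {f : EuclideanSpace ℝ (Fin n) → ℝ≥0∞}
    (hf : Measurable f) :
    ∫⁻ x, ballMax volume f x ^ s * ϖ x ≤
      K ^ (s / (s - 1)) *
      (2 * (K * ENNReal.ofReal (5 ^ n) ^ s) * ENNReal.ofReal (s / (s - 1) / (s / (s - 1) - 1)) *
        2 ^ (s / (s - 1) - 1)) *
      (2 * (K ^ (1 / (s - 1)) * ENNReal.ofReal (5 ^ n) ^ (s / (s - 1))) *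
        ENNReal.ofReal (s / (s - 1)) * 2 ^ (s - 1)) * ∫⁻ x, f x ^ s * ϖ x := by
  have hs : 1 < s := h.one_lt
  have h1 : 0 < s - 1 := by linarith
  have hd := h.dual
  set t := s / (s - 1) with ht
  have ht1 : 1 < t := hd.one_lt
  have hst : (s - 1) * t = s := by rw [ht]; field_simp
  set σ := fun z => ϖ z ^ (-1 / (s - 1)) with hσ
  set Mσ := ballMax (volume.withDensity σ) (fun z => f z / σ z) with hMσ
  set g := fun y => Mσ y ^ (s - 1) / ϖ y with hg
  have hMm : Measurable Mσ := measurable_ballMax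
  have hϖm := h.measurable
  have hσm := hd.measurable
  have hgm : Measurable g := (hMm.pow_const _).div hϖm
  set C₁ := 2 * (K * ENNReal.ofReal (5 ^ n) ^ s) * ENNReal.ofReal (t / (t - 1)) * 2 ^ (t - 1)
    with hC₁
  set C₂ := 2 * (K ^ (1 / (s - 1)) * ENNReal.ofReal (5 ^ n) ^ t) * ENNReal.ofReal (s / (s - 1)) *
    2 ^ (s - 1) with hC₂
  have step1 : ∫⁻ x, ballMax volume f x ^ s * ϖ x ≤
      K ^ t * ∫⁻ x, ballMax (volume.withDensity ϖ) g x ^ t ∂(volume.withDensity ϖ) := by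
    have hMg : Measurable fun x => ballMax (volume.withDensity ϖ) g x ^ t :=
      measurable_ballMax.pow_const _
    rw [lintegral_withDensity_eq_lintegral_mul _ hϖm hMg,
      ← lintegral_const_mul _ (hϖm.mul hMg)]
    refine lintegral_mono fun x => ?_
    have := ENNReal.rpow_le_rpow (h.ballMax_rpow_le hf x) (by linarith : 0 ≤ t)
    rw [← ENNReal.rpow_mul, hst, ENNReal.mul_rpow_of_nonneg _ _ (by linarith)] at this
    calc _ ≤ _ := mul_le_mul_left this (ϖ x)
      _ = _ := by simp only [Pi.mul_apply]; ring
  have step2 := ballMax_strong_type (μ := volume.withDensity ϖ) hgm ht1 h.doubling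
  -- The two weighted norms fit together: `(Mσ^(s-1) / ϖ)^t ϖ = Mσ^s ϖ^(1-t)` and `1 - t =
  -- -1/(s-1)`.
  have step3 : ∫⁻ x, g x ^ t ∂(volume.withDensity ϖ) = ∫⁻ x, Mσ x ^ s ∂(volume.withDensity σ) := by
    rw [lintegral_withDensity_eq_lintegral_mul _ hϖm (hgm.pow_const _),
      lintegral_withDensity_eq_lintegral_mul _ hσm (hMm.pow_const _)]
    refine lintegral_congr fun x => ?_
    simp only [Pi.mul_apply, hg, hσ]
    rw [ENNReal.div_rpow_of_nonneg _ _ (by linarith), ← ENNReal.rpow_mul, hst, div_eq_mul_inv,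
      ← ENNReal.rpow_neg]
    have e : ϖ x * ϖ x ^ (-t) = ϖ x ^ (-1 / (s - 1)) := by
      conv_lhs => enter [1]; rw [← ENNReal.rpow_one (ϖ x)]
      rw [← ENNReal.rpow_add _ _ (h.ne_zero x) (h.ne_top x)]
      congr 1
      rw [ht]; field_simp; ring
    rw [← e]; ring
  have step4 := ballMax_strong_type (μ := volume.withDensity σ)
    (g := fun x => f x / σ x) (hf.div hσm) hs hd.doubling
  have step5 : ∫⁻ x, (f x / σ x) ^ s ∂(volume.withDensity σ) = ∫⁻ x, f x ^ s * ϖ x := by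
    rw [lintegral_withDensity_eq_lintegral_mul _ hσm
      (g := fun x => (f x / σ x) ^ s) ((hf.div hσm).pow_const _)]
    refine lintegral_congr fun x => ?_
    simp only [Pi.mul_apply, hσ]
    rw [ENNReal.div_rpow_of_nonneg _ _ (by linarith), div_eq_mul_inv (f x ^ s), ← ENNReal.rpow_mul,
      ← ENNReal.rpow_neg]
    have e : ϖ x ^ (-1 / (s - 1)) * ϖ x ^ (-(-1 / (s - 1) * s)) = ϖ x := by
      rw [← ENNReal.rpow_add _ _ (h.ne_zero x) (h.ne_top x)]
      conv_rhs => rw [← ENNReal.rpow_one (ϖ x)]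
      congr 1
      field_simp; ring
    calc _ = f x ^ s * (ϖ x ^ (-1 / (s - 1)) * ϖ x ^ (-(-1 / (s - 1) * s))) := by ring
      _ = _ := by rw [e]
  calc _ ≤ K ^ t * (C₁ * (C₂ * ∫⁻ x, f x ^ s * ϖ x)) := by
        refine step1.trans (mul_le_mul_right (step2.trans (mul_le_mul_right ?_ _)) _)
        rw [step3, ← step5]
        exact step4
    _ = _ := by ring

end IsMuckenhoupt

/-- The maximal operator is bounded on `L^s(ϖ)`, uniformly over weights with constant `≤ K`. -/
theorem exists_ballMax_bound (n : ℕ) (s : ℝ) {K : ℝ≥0∞} (hK : K ≠ ⊤) :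
    ∃ N : ℝ≥0∞, N ≠ 0 ∧ N ≠ ⊤ ∧ ∀ ϖ : EuclideanSpace ℝ (Fin n) → ℝ≥0∞, IsMuckenhoupt s K ϖ →
      ∀ f, Measurable f → (∫⁻ x, ballMax volume f x ^ s * ϖ x) ^ (1 / s) ≤
        N * (∫⁻ x, f x ^ s * ϖ x) ^ (1 / s) := by
  by_cases hs : 1 < s
  swap
  · exact ⟨1, one_ne_zero, ENNReal.one_ne_top, fun ϖ h => absurd h.one_lt hs⟩
  have h1 : 0 < s - 1 := by linarith
  have hs' : s / (s - 1) - 1 = 1 / (s - 1) := by field_simp; ring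
  set Q := K ^ (s / (s - 1)) *
      (2 * (K * ENNReal.ofReal (5 ^ n) ^ s) * ENNReal.ofReal (s / (s - 1) / (s / (s - 1) - 1)) *
        2 ^ (s / (s - 1) - 1)) *
      (2 * (K ^ (1 / (s - 1)) * ENNReal.ofReal (5 ^ n) ^ (s / (s - 1))) *
        ENNReal.ofReal (s / (s - 1)) * 2 ^ (s - 1)) with hQ
  have hQt : Q ≠ ⊤ := by
    have p1 : ∀ {a : ℝ≥0∞} {b : ℝ}, a ≠ ⊤ → 0 ≤ b → a ^ b ≠ ⊤ := fun ha hb =>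
      ENNReal.rpow_ne_top_of_nonneg hb ha
    have e1 : 0 ≤ s / (s - 1) - 1 := by rw [hs']; positivity
    have e2 : 0 ≤ s / (s - 1) := by positivity
    refine ENNReal.mul_ne_top (ENNReal.mul_ne_top (p1 hK e2) ?_) ?_
    · exact ENNReal.mul_ne_top (ENNReal.mul_ne_top (ENNReal.mul_ne_top (by simp)
        (ENNReal.mul_ne_top hK (p1 ENNReal.ofReal_ne_top (by linarith)))) ENNReal.ofReal_ne_top)
        (p1 (by simp) e1)
    · exact ENNReal.mul_ne_top (ENNReal.mul_ne_top (ENNReal.mul_ne_top (by simp)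
        (ENNReal.mul_ne_top (p1 hK (by positivity)) (p1 ENNReal.ofReal_ne_top e2)))
        ENNReal.ofReal_ne_top) (p1 (by simp) h1.le)
  -- `Q + 1` instead of `Q` keeps the bound nonzero, as the iteration series divides by it.
  refine ⟨(Q + 1) ^ (1 / s), ?_, ?_, fun ϖ h f hf => ?_⟩
  · simp [ENNReal.rpow_eq_zero_iff, hQt]
  · exact ENNReal.rpow_ne_top_of_nonneg (by positivity) (by simp [hQt])
  · rw [← ENNReal.mul_rpow_of_nonneg _ _ (by positivity)]
    refine ENNReal.rpow_le_rpow ((h.lintegral_ballMax_rpow_le hf).trans ?_) (by positivity)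
    gcongr
    exact le_self_add

end Muckenhoupt

/-! ### The Rubio de Francia iteration. -/

/-- The Rubio de Francia iteration `∑ₖ Mᵏ h / (2N)ᵏ`. -/
noncomputable def rubioDeFrancia {n : ℕ} (N : ℝ≥0∞) (h : EuclideanSpace ℝ (Fin n) → ℝ≥0∞)
    (x : EuclideanSpace ℝ (Fin n)) : ℝ≥0∞ :=
  ∑' k : ℕ, (2 * N)⁻¹ ^ k * (ballMax volume)^[k] h x

section RubioDeFrancia

variable {n : ℕ} {N : ℝ≥0∞} {h g : EuclideanSpace ℝ (Fin n) → ℝ≥0∞}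

lemma measurable_iterate_ballMax (hh : Measurable h) (k : ℕ) :
    Measurable ((ballMax volume)^[k] h) := by
  cases k with
  | zero => exact hh
  | succ k => rw [Function.iterate_succ_apply']; exact measurable_ballMax

lemma measurable_rubioDeFrancia (hh : Measurable h) : Measurable (rubioDeFrancia N h) :=
  Measurable.tsum fun k => (measurable_iterate_ballMax hh k).const_mul _

lemma le_rubioDeFrancia (x) : h x ≤ rubioDeFrancia N h x := by
  simpa [rubioDeFrancia] using ENNReal.le_tsum (f := fun k : ℕ => (2 * N)⁻¹ ^ k * (ballMax volume)^[k] h x) 0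

/-- By countable sublinearity the maximal operator shifts the series by one term, which costs one
factor `2 * N`. Thus the sum is an `A_1` weight with constant `2 * N`. -/
lemma ballMax_rubioDeFrancia_le (hh : Measurable h) (h0 : N ≠ 0) (ht : N ≠ ⊤) (x) :
    ballMax volume (rubioDeFrancia N h) x ≤ 2 * N * rubioDeFrancia N h x := by
  have h20 : 2 * N ≠ 0 := by simp [h0]
  have h2t : 2 * N ≠ ⊤ := ENNReal.mul_ne_top (by simp) ht
  calc ballMax volume (rubioDeFrancia N h) x
      ≤ ∑' k : ℕ, ballMax volume (fun y => (2 * N)⁻¹ ^ k * (ballMax volume)^[k] h y) x :=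
        ballMax_tsum_le (fun k => (measurable_iterate_ballMax hh k).const_mul _) x
    _ = ∑' k : ℕ, 2 * N * ((2 * N)⁻¹ ^ (k + 1) * (ballMax volume)^[k + 1] h x) := by
        refine tsum_congr fun k => ?_
        rw [ballMax_const_mul (measurable_iterate_ballMax hh k), Function.iterate_succ_apply',
          pow_succ']
        calc _ = (2 * N * (2 * N)⁻¹) * ((2 * N)⁻¹ ^ k *
              ballMax volume ((ballMax volume)^[k] h) x) := by
              rw [ENNReal.mul_inv_cancel h20 h2t, one_mul]
          _ = _ := by ring
    _ = 2 * N * ∑' k : ℕ, (2 * N)⁻¹ ^ (k + 1) * (ballMax volume)^[k + 1] h x :=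
        ENNReal.tsum_mul_left
    _ ≤ _ := by
        gcongr
        exact ENNReal.tsum_comp_le_tsum_of_injective (add_left_injective 1)
          (fun k : ℕ => (2 * N)⁻¹ ^ k * (ballMax volume)^[k] h x)

lemma setLIntegral_div_le_rubioDeFrancia (hh : Measurable h) (h0 : N ≠ 0) (ht : N ≠ ⊤)
    {x y : EuclideanSpace ℝ (Fin n)} {r : ℝ} (hx : x ∈ ball y r) :
    (∫⁻ z in ball y r, rubioDeFrancia N h z) / volume (ball y r) ≤
      2 * N * rubioDeFrancia N h x :=
  (le_ballMax hx).trans (ballMax_rubioDeFrancia_le hh h0 ht x)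

/-- A zero at one point forces, by the `A_1` inequality, zero averages over all balls around it, and
`h` lies below the series. Hence positivity holds at every point, not only almost everywhere. -/
lemma rubioDeFrancia_ne_zero (hh : Measurable h) (h0 : N ≠ 0) (ht : N ≠ ⊤)
    (hne : ∫⁻ x, h x ≠ 0) (x) : rubioDeFrancia N h x ≠ 0 := by
  intro hx
  have hM := ballMax_rubioDeFrancia_le hh h0 ht x
  rw [hx, mul_zero] at hM
  refine hne ?_
  have key : ∀ k : ℕ, ∫⁻ z in ball x k, h z = 0 := by
    intro k
    rcases Nat.eq_zero_or_pos k with rfl | hk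
    · simp
    · have hk' : (0 : ℝ) < k := by exact_mod_cast hk
      have h1 := (le_ballMax (μ := volume) (g := rubioDeFrancia N h)
        (mem_ball_self (x := x) hk')).trans hM
      rw [nonpos_iff_eq_zero, ENNReal.div_eq_zero_iff] at h1
      rcases h1 with h1 | h1
      · exact nonpos_iff_eq_zero.1 ((lintegral_mono fun z => le_rubioDeFrancia z).trans h1.le)
      · exact absurd h1 (volume_ball_ne_top x k)
  have hU : (⋃ k : ℕ, ball x (k : ℝ)) = univ := iUnion_ball_nat x
  rw [← setLIntegral_univ, ← hU]
  exact nonpos_iff_eq_zero.1 ((lintegral_iUnion_le _ _).trans (by simp [key]))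

/-- The `k`-th term contributes at most `2⁻ᵏ` times the bound for `h`, and the geometric series sums
to 2. The functional `nrm` is abstract so that the lemma serves both the weighted space and its
dual; `b` plays the dual norm of `g`. -/
lemma lintegral_rubioDeFrancia_mul_le (hh : Measurable h) (h0 : N ≠ 0) (ht : N ≠ ⊤)
    (hg : Measurable g) (nrm : (EuclideanSpace ℝ (Fin n) → ℝ≥0∞) → ℝ≥0∞) (b : ℝ≥0∞)
    (hnrm : ∀ f, Measurable f → nrm (ballMax volume f) ≤ N * nrm f)
    (hb : ∀ f, Measurable f → ∫⁻ x, f x * g x ≤ nrm f * b) :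
    ∫⁻ x, rubioDeFrancia N h x * g x ≤ 2 * (nrm h * b) := by
  have hit : ∀ k : ℕ, nrm ((ballMax volume)^[k] h) ≤ N ^ k * nrm h := by
    intro k
    induction k with
    | zero => simp
    | succ k ih =>
      rw [Function.iterate_succ_apply', pow_succ']
      calc _ ≤ N * nrm ((ballMax volume)^[k] h) := hnrm _ (measurable_iterate_ballMax hh k)
        _ ≤ N * (N ^ k * nrm h) := by gcongr
        _ = _ := by ring
  calc ∫⁻ x, rubioDeFrancia N h x * g x
      = ∫⁻ x, ∑' k : ℕ, (2 * N)⁻¹ ^ k * ((ballMax volume)^[k] h x * g x) := by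
        refine lintegral_congr fun x => ?_
        rw [rubioDeFrancia, ← ENNReal.tsum_mul_right]
        exact tsum_congr fun k => by ring
    _ = ∑' k : ℕ, (2 * N)⁻¹ ^ k * ∫⁻ x, (ballMax volume)^[k] h x * g x := by
        have hm : ∀ k, Measurable fun x => (ballMax volume)^[k] h x * g x := fun k =>
          (measurable_iterate_ballMax hh k).mul hg
        rw [lintegral_tsum fun k => ((hm k).const_mul _).aemeasurable]
        exact tsum_congr fun k =>
          lintegral_const_mul _ (hm k)
    _ ≤ ∑' k : ℕ, 2⁻¹ ^ k * (nrm h * b) := by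
        refine ENNReal.tsum_le_tsum fun k => ?_
        calc _ ≤ (2 * N)⁻¹ ^ k * (N ^ k * nrm h * b) := by
              gcongr
              exact (hb _ (measurable_iterate_ballMax hh k)).trans (mul_le_mul_left (hit k) b)
          _ = 2⁻¹ ^ k * (N⁻¹ * N) ^ k * (nrm h * b) := by
              rw [ENNReal.mul_inv (by simp) (by simp), mul_pow, mul_pow]; ring
          _ = _ := by rw [ENNReal.inv_mul_cancel h0 ht, one_pow, mul_one]
    _ = _ := by
        rw [ENNReal.tsum_mul_right, ENNReal.tsum_geometric, ENNReal.one_sub_inv_two, inv_inv]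

end RubioDeFrancia

/-! ### Unnormalized `A_s` inequality and reverse factorization. -/

section Weights

variable {n : ℕ} {s : ℝ}

lemma ENNReal.rpow_le_rpow_of_exponent_nonpos {a b : ℝ≥0∞} {c : ℝ} (hab : a ≤ b) (hc : c ≤ 0) :
    b ^ c ≤ a ^ c := by
  rw [← neg_neg c, ENNReal.rpow_neg b, ENNReal.rpow_neg a]
  exact ENNReal.inv_le_inv.2 (ENNReal.rpow_le_rpow hab (neg_nonneg.2 hc))

lemma apConst_le_iff {w : EuclideanSpace ℝ (Fin n) → ℝ} {V : EuclideanSpace ℝ (Fin n) → ℝ≥0∞}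
    {K : ℝ≥0∞} (hs : 1 < s) (hwV : ∀ᵐ x, ENNReal.ofReal (w x) = V x) :
    apConst s w ≤ K ↔ ∀ x r, 0 < r → (∫⁻ y in ball x r, V y) *
      (∫⁻ y in ball x r, V y ^ (-1 / (s - 1))) ^ (s - 1) ≤ K * volume (ball x r) ^ s := by
  have h1 : 0 < s - 1 := by linarith
  simp only [apConst, iSup_le_iff]
  refine forall_congr' fun x => forall_congr' fun r => forall_congr' fun hr => ?_
  have e1 : ∫⁻ y in ball x r, ENNReal.ofReal (w y) = ∫⁻ y in ball x r, V y :=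
    lintegral_congr_ae (ae_restrict_of_ae hwV)
  have e2 : ∫⁻ y in ball x r, ENNReal.ofReal (w y) ^ (-1 / (s - 1)) =
      ∫⁻ y in ball x r, V y ^ (-1 / (s - 1)) :=
    lintegral_congr_ae (ae_restrict_of_ae (hwV.mono fun y hy => by simp only [hy]))
  have hm0 := volume_ball_ne_zero x hr
  have hmt := volume_ball_ne_top x r
  rw [setLAverage_eq, setLAverage_eq, e1, e2, ENNReal.div_rpow_of_nonneg _ _ h1.le]
  set m := volume (ball x r)
  have hms : m * m ^ (s - 1) = m ^ s := by
    conv_lhs => enter [1]; rw [← ENNReal.rpow_one m]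
    rw [← ENNReal.rpow_add _ _ hm0 hmt]; congr 1; ring
  have hp0 : m ^ s ≠ 0 := by simp [ENNReal.rpow_eq_zero_iff, hm0, hmt]
  have hpt : m ^ s ≠ ⊤ := ENNReal.rpow_ne_top_of_nonneg (by linarith) hmt
  rw [← ENNReal.div_le_iff hp0 hpt, ← hms, div_eq_mul_inv _ (m * _),
    ENNReal.mul_inv (Or.inl hm0) (Or.inl hmt), div_eq_mul_inv, div_eq_mul_inv _ (m ^ _)]
  ring_nf

/-- Reverse factorization: `A^{1-s} B` is an `A_s` weight if `A`, `B` are `A_1` weights. -/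
lemma bound_of_factorization {A B : EuclideanSpace ℝ (Fin n) → ℝ≥0∞} {a b : ℝ≥0∞} (hs : 1 < s)
    (hA : Measurable A) (hB : Measurable B) (ha0 : a ≠ 0) (hat : a ≠ ⊤) (hb0 : b ≠ 0) (hbt : b ≠ ⊤)
    (hA0 : ∀ x, A x ≠ 0) (hB0 : ∀ x, B x ≠ 0)
    (hAt : ∀ x r, ∫⁻ y in ball x r, A y ≠ ⊤) (hBt : ∀ x r, ∫⁻ y in ball x r, B y ≠ ⊤)
    (hA1 : ∀ x y r, x ∈ ball y r → (∫⁻ z in ball y r, A z) / volume (ball y r) ≤ a * A x)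
    (hB1 : ∀ x y r, x ∈ ball y r → (∫⁻ z in ball y r, B z) / volume (ball y r) ≤ b * B x)
    (x) (r : ℝ) (hr : 0 < r) :
    ∫⁻ y in ball x r, A y ^ (1 - s) * B y ≠ ⊤ ∧
    (∫⁻ y in ball x r, A y ^ (1 - s) * B y) *
      (∫⁻ y in ball x r, (A y ^ (1 - s) * B y) ^ (-1 / (s - 1))) ^ (s - 1) ≤
      a ^ (s - 1) * b * volume (ball x r) ^ s := by
  have h1 : 0 < s - 1 := by linarith
  set m := volume (ball x r) with hm
  set I := ∫⁻ y in ball x r, A y with hI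
  set J := ∫⁻ y in ball x r, B y with hJ
  have hm0 : m ≠ 0 := volume_ball_ne_zero x hr
  have hmt : m ≠ ⊤ := volume_ball_ne_top x r
  have hI0 : I ≠ 0 :=
    setLIntegral_ball_ne_zero hA.aemeasurable (Filter.Eventually.of_forall hA0) x hr
  have hJ0 : J ≠ 0 :=
    setLIntegral_ball_ne_zero hB.aemeasurable (Filter.Eventually.of_forall hB0) x hr
  have hIt : I ≠ ⊤ := hAt x r
  have hJt : J ≠ ⊤ := hBt x r
  -- `α` and `β` are the lower bounds for `A` and `B` on the ball given by their `A_1` inequalities.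
  -- They are used on the factors with negative exponents.
  set α := I / m / a with hα
  set β := J / m / b with hβ
  have hα0 : α ≠ 0 := by simp [hα, hI0, hmt, hat]
  have hαt : α ≠ ⊤ := ENNReal.div_ne_top (ENNReal.div_ne_top hIt hm0) ha0
  have hβ0 : β ≠ 0 := by simp [hβ, hJ0, hmt, hbt]
  have hβt : β ≠ ⊤ := ENNReal.div_ne_top (ENNReal.div_ne_top hJt hm0) hb0
  have hαA : ∀ y ∈ ball x r, α ≤ A y := fun y hy => ENNReal.div_le_of_le_mul' (hA1 y x r hy)
  have hβB : ∀ y ∈ ball x r, β ≤ B y := fun y hy => ENNReal.div_le_of_le_mul' (hB1 y x r hy)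
  have hIV : ∫⁻ y in ball x r, A y ^ (1 - s) * B y ≤ α ^ (1 - s) * J := by
    rw [hJ, ← lintegral_const_mul _ hB]
    refine setLIntegral_mono (hB.const_mul _) fun y hy => ?_
    gcongr ?_ * _
    exact ENNReal.rpow_le_rpow_of_exponent_nonpos (hαA y hy) (by linarith)
  have hIS : ∫⁻ y in ball x r, (A y ^ (1 - s) * B y) ^ (-1 / (s - 1)) ≤
      β ^ (-1 / (s - 1)) * I := by
    rw [hI, ← lintegral_const_mul _ hA]
    -- The power of a product splits in `[0,∞]` only away from `0 * ∞`, hence the restriction to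
    -- points where both factors are finite.
    have hAfin : ∀ᵐ y ∂(volume.restrict (ball x r)), A y < ⊤ := ae_lt_top hA hIt
    have hBfin : ∀ᵐ y ∂(volume.restrict (ball x r)), B y < ⊤ := ae_lt_top hB hJt
    refine lintegral_mono_ae ?_
    filter_upwards [hAfin, hBfin, ae_restrict_mem measurableSet_ball] with y hy1 hy2 hy
    rw [ENNReal.mul_rpow_of_ne_top
      (by simp [ENNReal.rpow_eq_top_iff, hA0 y, hy1.ne]) hy2.ne, ← ENNReal.rpow_mul]
    have : (1 - s) * (-1 / (s - 1)) = 1 := by field_simp; ring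
    rw [this, ENNReal.rpow_one, mul_comm]
    gcongr ?_ * _
    exact ENNReal.rpow_le_rpow_of_exponent_nonpos (hβB y hy) (by
      rw [neg_div]; exact neg_nonpos.2 (by positivity))
  refine ⟨ne_top_of_le_ne_top (ENNReal.mul_ne_top ?_ hJt) hIV, ?_⟩
  · simp [ENNReal.rpow_eq_top_iff, hα0, hαt]
  have hII : I = a * m * α := by
    rw [hα, mul_comm a m, mul_assoc, ENNReal.mul_div_cancel ha0 hat, ENNReal.mul_div_cancel hm0 hmt]
  have hJJ : J = b * m * β := by
    rw [hβ, mul_comm b m, mul_assoc, ENNReal.mul_div_cancel hb0 hbt, ENNReal.mul_div_cancel hm0 hmt]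
  calc _ ≤ α ^ (1 - s) * J * (β ^ (-1 / (s - 1)) * I) ^ (s - 1) :=
        mul_le_mul' hIV (ENNReal.rpow_le_rpow hIS h1.le)
    _ = (α ^ (1 - s) * α ^ (s - 1)) * (β ^ (-1 : ℝ) * β) * (a ^ (s - 1) * b *
        (m ^ (s - 1) * m)) := by
        rw [ENNReal.mul_rpow_of_nonneg _ _ h1.le, ← ENNReal.rpow_mul,
          div_mul_cancel₀ _ h1.ne', hII, hJJ, ENNReal.mul_rpow_of_nonneg _ _ h1.le,
          ENNReal.mul_rpow_of_nonneg _ _ h1.le]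
        ring
    _ = _ := by
        rw [← ENNReal.rpow_add _ _ hα0 hαt, ENNReal.rpow_neg_one, ENNReal.inv_mul_cancel hβ0 hβt]
        have : m ^ (s - 1) * m = m ^ s := by
          conv_lhs => enter [2]; rw [← ENNReal.rpow_one m]
          rw [← ENNReal.rpow_add _ _ hm0 hmt, sub_add_cancel]
        rw [this]
        simp

end Weights

/-! ### Real-valued weights, and weights with a prescribed constant. -/

section RealWeights

variable {n : ℕ} {s : ℝ}

lemma isApWeight_toReal {V : EuclideanSpace ℝ (Fin n) → ℝ≥0∞} {K : ℝ≥0∞} (hs : 1 < s)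
    (hVm : AEMeasurable V) (hVi : ∀ x r, 0 < r → ∫⁻ y in ball x r, V y ≠ ⊤)
    (hVt : ∀ᵐ x, V x ≠ ⊤) (hK : K ≠ ⊤)
    (hV : ∀ x r, 0 < r → (∫⁻ y in ball x r, V y) *
      (∫⁻ y in ball x r, V y ^ (-1 / (s - 1))) ^ (s - 1) ≤ K * volume (ball x r) ^ s) :
    IsApWeight s (fun x => (V x).toReal) ∧ apConst s (fun x => (V x).toReal) ≤ K := by
  have hle : apConst s (fun x => (V x).toReal) ≤ K :=
    (apConst_le_iff hs (hVt.mono fun x hx => ENNReal.ofReal_toReal hx)).2 hV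
  refine ⟨⟨fun x => ENNReal.toReal_nonneg, fun x => ?_, hle.trans_lt hK.lt_top⟩, hle⟩
  exact ⟨ball x 1, ball_mem_nhds x one_pos,
    integrable_toReal_of_lintegral_ne_top hVm.restrict (hVi x 1 one_pos)⟩

/-- In each direction only one of the two averages can grow, and it costs exactly one factor `d`.
This gives continuity of the constant under rescaling of the weight on a set. -/
lemma apConst_compare {w₁ w₂ : EuclideanSpace ℝ (Fin n) → ℝ} {d : ℝ} (hs : 1 < s) (hd : 0 < d)
    (h12 : ∀ x, w₁ x ≤ w₂ x) (h21 : ∀ x, w₂ x ≤ d * w₁ x) :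
    apConst s w₂ ≤ ENNReal.ofReal d * apConst s w₁ ∧
      apConst s w₁ ≤ ENNReal.ofReal d * apConst s w₂ := by
  have h1 : 0 < s - 1 := by linarith
  have hneg : -1 / (s - 1) ≤ 0 := by rw [neg_div]; exact neg_nonpos.2 (by positivity)
  have hd0 : ENNReal.ofReal d ≠ 0 := by simpa using hd
  have key : ∀ x, ENNReal.ofReal (w₂ x) ≤ ENNReal.ofReal d * ENNReal.ofReal (w₁ x) := fun x => by
    rw [← ENNReal.ofReal_mul hd.le]; exact ENNReal.ofReal_le_ofReal (h21 x)
  constructor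
  · refine iSup₂_le fun x r => iSup_le fun hr => ?_
    refine le_trans ?_ (mul_le_mul_right (le_iSup₂_of_le x r (le_iSup_of_le hr le_rfl)) _)
    rw [← mul_assoc]
    refine mul_le_mul' ?_ (ENNReal.rpow_le_rpow (lintegral_mono fun y => ?_) h1.le)
    · rw [laverage, laverage, ← lintegral_const_mul' _ _ ENNReal.ofReal_ne_top]
      exact lintegral_mono fun y => key y
    · exact ENNReal.rpow_le_rpow_of_exponent_nonpos (ENNReal.ofReal_le_ofReal (h12 y)) hneg
  · refine iSup₂_le fun x r => iSup_le fun hr => ?_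
    refine le_trans ?_ (mul_le_mul_right (le_iSup₂_of_le x r (le_iSup_of_le hr le_rfl)) _)
    rw [← mul_assoc, mul_comm (ENNReal.ofReal d), mul_assoc]
    refine mul_le_mul' (lintegral_mono fun y => ENNReal.ofReal_le_ofReal (h12 y)) ?_
    have e : ENNReal.ofReal d = (ENNReal.ofReal d ^ (1 / (s - 1))) ^ (s - 1) := by
      rw [← ENNReal.rpow_mul, one_div_mul_cancel h1.ne', ENNReal.rpow_one]
    rw [e, ← ENNReal.mul_rpow_of_nonneg _ _ h1.le]
    refine ENNReal.rpow_le_rpow ?_ h1.le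
    rw [laverage, laverage, ← lintegral_const_mul' _ _
      (ENNReal.rpow_ne_top_of_nonneg (by positivity) ENNReal.ofReal_ne_top)]
    refine lintegral_mono fun y => ?_
    have := ENNReal.rpow_le_rpow_of_exponent_nonpos (key y) hneg
    calc ENNReal.ofReal (w₁ y) ^ (-1 / (s - 1)) =
        ENNReal.ofReal d ^ (1 / (s - 1)) * (ENNReal.ofReal d ^ (-1 / (s - 1)) *
          ENNReal.ofReal (w₁ y) ^ (-1 / (s - 1))) := by
          rw [← mul_assoc, ← ENNReal.rpow_add _ _ hd0 ENNReal.ofReal_ne_top]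
          rw [show 1 / (s - 1) + -1 / (s - 1) = 0 by ring, ENNReal.rpow_zero, one_mul]
      _ ≤ _ := by
          gcongr
          refine le_trans (le_of_eq ?_) this
          rw [ENNReal.mul_rpow_of_ne_top ENNReal.ofReal_ne_top ENNReal.ofReal_ne_top]

/-- Any value above the `A_s` constant of `v` is attained by multiplying `v` by a constant on a
ball. -/
lemma exists_isApWeight_apConst_eq {v : EuclideanSpace ℝ (Fin n) → ℝ} (hs : 1 < s)
    (hv : IsApWeight s v) (hv0 : ∀ᵐ x, v x ≠ 0) {κ : ℝ≥0∞} (hκ : κ ≠ ⊤) (hvκ : apConst s v ≤ κ)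
    {z y : EuclideanSpace ℝ (Fin n)} (hzy : Disjoint (ball z 1) (ball y 1)) :
    ∃ v' : EuclideanSpace ℝ (Fin n) → ℝ, IsApWeight s v' ∧ apConst s v' = κ ∧
      ∀ x ∉ ball z 1, v' x = v x := by
  classical
  have h1 : 0 < s - 1 := by linarith
  let u : ℝ → EuclideanSpace ℝ (Fin n) → ℝ := fun c x => if x ∈ ball z 1 then c * v x else v x
  have hu_le : ∀ c d : ℝ, c ≤ d → ∀ x, u c x ≤ u d x := by
    intro c d hcd x
    by_cases hx : x ∈ ball z 1
    · simp only [u, hx, if_true]; exact mul_le_mul_of_nonneg_right hcd (hv.nonneg x)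
    · simp only [u, hx, if_false]; exact le_rfl
  have hu_ge : ∀ c d : ℝ, 1 ≤ c → c ≤ d → ∀ x, u d x ≤ d / c * u c x := by
    intro c d hc hcd x
    have hc0 : 0 < c := by linarith
    by_cases hx : x ∈ ball z 1
    · simp only [u, hx, if_true]; rw [← mul_assoc, div_mul_cancel₀ _ hc0.ne']
    · simp only [u, hx, if_false]
      exact le_mul_of_one_le_left (hv.nonneg x) ((one_le_div hc0).2 hcd)
  have hcmp : ∀ c d : ℝ, 1 ≤ c → c ≤ d →
      apConst s (u d) ≤ ENNReal.ofReal (d / c) * apConst s (u c) ∧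
      apConst s (u c) ≤ ENNReal.ofReal (d / c) * apConst s (u d) := fun c d hc hcd =>
    apConst_compare hs (by apply div_pos <;> linarith) (hu_le c d hcd) (hu_ge c d hc hcd)
  have hu1 : u 1 = v := by
    funext x; simp [u]
  have hfin : ∀ c, 1 ≤ c → apConst s (u c) ≠ ⊤ := by
    intro c hc
    refine ne_top_of_le_ne_top ?_ (hcmp 1 c le_rfl hc).1
    rw [hu1]
    exact ENNReal.mul_ne_top ENNReal.ofReal_ne_top hv.apConst_lt_top.ne
  have hvm : AEMeasurable (fun x => ENNReal.ofReal (v x)) :=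
    hv.locallyIntegrable.aestronglyMeasurable.aemeasurable.ennreal_ofReal
  -- On a ball containing both unit balls, the average of `u T` grows at least linearly in `T`,
  -- while the dual average stays bounded below by the part over `ball y 1`, where the weight is
  -- unchanged. So the constant eventually reaches `κ`.
  obtain ⟨T, hT1, hTκ⟩ : ∃ T : ℝ, 1 ≤ T ∧ κ ≤ apConst s (u T) := by
    set R := dist y z + 1 with hR
    have hR0 : 0 < R := by positivity
    have hyR : ball y 1 ⊆ ball z R := fun x hx => by
      rw [mem_ball] at hx ⊢
      linarith [dist_triangle x y z]
    have hzR : ball z 1 ⊆ ball z R := ball_subset_ball (by linarith [dist_nonneg (x := y) (y := z)])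
    set m := volume (ball z R)
    have hm0 : m ≠ 0 := volume_ball_ne_zero z hR0
    have hmt : m ≠ ⊤ := volume_ball_ne_top z R
    set I := ∫⁻ x in ball z 1, ENNReal.ofReal (v x) with hI
    set J := ∫⁻ x in ball y 1, ENNReal.ofReal (v x) ^ (-1 / (s - 1)) with hJ
    have hI0 : I ≠ 0 := setLIntegral_ball_ne_zero hvm (hv0.mono fun x hx => by
      simpa using lt_of_le_of_ne (hv.nonneg x) hx.symm) z one_pos
    have hJ0 : J ≠ 0 := by
      refine setLIntegral_ball_ne_zero (hvm.pow_const _) (Filter.Eventually.of_forall fun x => ?_)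
        y one_pos
      have : ¬ 0 < -1 / (s - 1) := by
        rw [not_lt, neg_div]; exact neg_nonpos.2 (by positivity)
      simp [ENNReal.rpow_eq_zero_iff, this]
    set k := I / m * (J / m) ^ (s - 1) with hk
    have hk0 : k ≠ 0 := by
      refine mul_ne_zero (ENNReal.div_ne_zero.2 ⟨hI0, hmt⟩) ?_
      have : J / m ≠ 0 := ENNReal.div_ne_zero.2 ⟨hJ0, hmt⟩
      simp only [Ne, ENNReal.rpow_eq_zero_iff, this, false_and, false_or, not_and, not_lt]
      exact fun _ => h1.le
    obtain ⟨N, hN⟩ := ENNReal.exists_nat_mul_gt hk0 hκ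
    have hT1 : (1 : ℝ) ≤ N + 1 := by linarith [(Nat.cast_nonneg N : (0 : ℝ) ≤ N)]
    refine ⟨N + 1, hT1, ?_⟩
    calc κ ≤ N * k := hN.le
      _ ≤ ENNReal.ofReal (N + 1) * k := by
          gcongr
          rw [← ENNReal.ofReal_natCast]
          exact ENNReal.ofReal_le_ofReal (by linarith)
      _ ≤ (⨍⁻ x in ball z R, ENNReal.ofReal (u (N + 1) x) ∂volume) *
          (⨍⁻ x in ball z R, ENNReal.ofReal (u (N + 1) x) ^ (-1 / (s - 1)) ∂volume) ^ (s - 1) := by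
          rw [hk, ← mul_assoc, setLAverage_eq, setLAverage_eq, ← mul_div_assoc]
          refine mul_le_mul' (ENNReal.div_le_div_right ?_ _)
            (ENNReal.rpow_le_rpow (ENNReal.div_le_div_right ?_ _) h1.le)
          · rw [hI, ← lintegral_const_mul' _ _ ENNReal.ofReal_ne_top]
            refine le_trans (le_of_eq ?_) (lintegral_mono_set hzR)
            refine setLIntegral_congr_fun measurableSet_ball fun x hx => ?_
            simp only [u, hx, if_true]
            rw [ENNReal.ofReal_mul (by linarith)]
          · refine le_trans (le_of_eq ?_) (lintegral_mono_set hyR)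
            refine setLIntegral_congr_fun measurableSet_ball fun x hx => ?_
            have : x ∉ ball z 1 := fun hx' => disjoint_left.1 hzy hx' hx
            simp only [u, this, if_false]
      _ ≤ apConst s (u (N + 1)) := le_iSup₂_of_le z R (le_iSup_of_le hR0 le_rfl)
  have hφ : ∀ c d : ℝ, 1 ≤ c → c ≤ d →
      (apConst s (u d)).toReal ≤ d / c * (apConst s (u c)).toReal ∧
      (apConst s (u c)).toReal ≤ d / c * (apConst s (u d)).toReal := by
    intro c d hc hcd
    have hdc : 0 ≤ d / c := by apply div_nonneg <;> linarith
    obtain ⟨h1, h2⟩ := hcmp c d hc hcd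
    have h1' := ENNReal.toReal_mono (ENNReal.mul_ne_top ENNReal.ofReal_ne_top (hfin c hc)) h1
    have h2' := ENNReal.toReal_mono
      (ENNReal.mul_ne_top ENNReal.ofReal_ne_top (hfin d (hc.trans hcd))) h2
    rw [ENNReal.toReal_mul, ENNReal.toReal_ofReal hdc] at h1' h2'
    exact ⟨h1', h2'⟩
  set φ : ℝ → ℝ := fun c => (apConst s (u c)).toReal with hφdef
  have hφ0 : ∀ c, 0 ≤ φ c := fun c => ENNReal.toReal_nonneg
  have hφT : ∀ c ∈ Icc 1 T, φ c ≤ T * φ 1 := fun c hc => by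
    have := (hφ 1 c le_rfl hc.1).1
    rw [div_one] at this
    exact this.trans (mul_le_mul_of_nonneg_right hc.2 (hφ0 1))
  -- The comparison with ratio `d / c` bounds the difference by `d / c - 1` times a value of `φ`;
  -- since `c ≥ 1`, this makes `φ` Lipschitz on `[1, T]`, ready for the intermediate value theorem.
  have hlip : ∀ c ∈ Icc 1 T, ∀ d ∈ Icc 1 T, c ≤ d → |φ c - φ d| ≤ T * φ 1 * (d - c) := by
    intro c hc d hd hcd
    obtain ⟨h1, h2⟩ := hφ c d hc.1 hcd
    have hc0 : 0 < c := by linarith [hc.1]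
    have hq : d / c - 1 ≤ d - c := by
      rw [div_sub_one hc0.ne', div_le_iff₀ hc0]
      nlinarith [hc.1]
    have hq0 : 0 ≤ d / c - 1 := by rw [sub_nonneg, one_le_div hc0]; exact hcd
    have e1 : (d / c - 1) * φ c ≤ (d - c) * (T * φ 1) :=
      mul_le_mul hq (hφT c hc) (hφ0 c) (by linarith)
    have e2 : (d / c - 1) * φ d ≤ (d - c) * (T * φ 1) :=
      mul_le_mul hq (hφT d hd) (hφ0 d) (by linarith)
    rw [abs_le]
    constructor <;> linarith
  have hcont : ContinuousOn φ (Icc 1 T) := by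
    have : LipschitzOnWith (T * φ 1).toNNReal φ (Icc 1 T) := by
      refine LipschitzOnWith.of_dist_le_mul fun c hc d hd => ?_
      rw [Real.coe_toNNReal _ (mul_nonneg (by linarith) (hφ0 1)), Real.dist_eq, Real.dist_eq]
      rcases le_total c d with hcd | hcd
      · rw [abs_sub_comm c d, abs_of_nonneg (sub_nonneg.2 hcd)]
        exact hlip c hc d hd hcd
      · rw [abs_sub_comm, abs_of_nonneg (sub_nonneg.2 hcd)]
        exact hlip d hd c hc hcd
    exact this.continuousOn
  have hmem : κ.toReal ∈ Icc (φ 1) (φ T) := by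
    refine ⟨?_, ENNReal.toReal_mono (hfin T hT1) hTκ⟩
    refine ENNReal.toReal_mono hκ ?_
    rw [hu1]; exact hvκ
  obtain ⟨c, hc, hφc⟩ := intermediate_value_Icc hT1 hcont hmem
  have hceq : apConst s (u c) = κ := (ENNReal.toReal_eq_toReal_iff' (hfin c hc.1) hκ).1 hφc
  refine ⟨u c, ⟨fun x => ?_, ?_, (hfin c hc.1).lt_top⟩, hceq, fun x hx => ?_⟩
  · exact (hv.nonneg x).trans (by rw [← hu1] ; exact hu_le 1 c hc.1 x)
  · have hbig : LocallyIntegrable (fun x => c * v x) := hv.locallyIntegrable.smul c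
    refine hbig.mono ?_ (Filter.Eventually.of_forall fun x => ?_)
    · exact (hbig.aestronglyMeasurable.restrict.piecewise measurableSet_ball
        hv.locallyIntegrable.aestronglyMeasurable.restrict :)
    · have h2 := hu_ge 1 c le_rfl hc.1 x
      have h3 : 0 ≤ u c x := (hv.nonneg x).trans (by rw [← hu1] ; exact hu_le 1 c hc.1 x)
      rw [hu1, div_one] at h2
      rw [Real.norm_of_nonneg h3]
      exact h2.trans (le_abs_self _)
  · simp only [u, hx, if_false]

/-- Otherwise some large ball carries positive mass of `w` and meets the zero set in positive
measure. There `0 ^ (-1/(s-1)) = ∞` makes the dual average, hence the constant, infinite. The zero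
function itself is not excluded, since `0 * ∞ = 0`. -/
lemma IsApWeight.ae_eq_zero_or_ae_ne_zero {w : EuclideanSpace ℝ (Fin n) → ℝ} (hs : 1 < s)
    (hw : IsApWeight s w) :
    (∀ᵐ x, ENNReal.ofReal (w x) = 0) ∨ ∀ᵐ x, ENNReal.ofReal (w x) ≠ 0 := by
  have h1 : 0 < s - 1 := by linarith
  have hwm : AEMeasurable (fun x => ENNReal.ofReal (w x)) :=
    hw.locallyIntegrable.aestronglyMeasurable.aemeasurable.ennreal_ofReal
  by_contra hcon
  obtain ⟨hne, hZ⟩ := not_or.1 hcon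
  set Z : Set (EuclideanSpace ℝ (Fin n)) := {x | ENNReal.ofReal (w x) = 0} with hZdef
  have hZ0 : volume Z ≠ 0 := by
    intro h0
    refine hZ ?_
    rw [Filter.Eventually, mem_ae_iff]
    convert h0 using 2
    ext x
    simp [hZdef]
  have hU : (⋃ k : ℕ, ball (0 : EuclideanSpace ℝ (Fin n)) (k : ℝ)) = univ := iUnion_ball_nat 0
  obtain ⟨k, hk⟩ : ∃ k : ℕ, volume (Z ∩ ball 0 (k : ℝ)) ≠ 0 := by
    by_contra! hcon
    refine hZ0 ?_
    rw [← inter_univ Z, ← hU, inter_iUnion]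
    exact measure_iUnion_null hcon
  obtain ⟨l, hl⟩ : ∃ l : ℕ, ∫⁻ x in ball 0 (l : ℝ), ENNReal.ofReal (w x) ≠ 0 := by
    by_contra! hcon
    have : ∫⁻ x, ENNReal.ofReal (w x) = 0 := by
      rw [← setLIntegral_univ, ← hU]
      exact nonpos_iff_eq_zero.1 ((lintegral_iUnion_le _ _).trans (by simp [hcon]))
    rw [lintegral_eq_zero_iff' hwm] at this
    exact hne this
  set R : ℝ := (k : ℝ) + l + 1 with hR
  have hR0 : 0 < R := by positivity
  have hI : ∫⁻ x in ball 0 R, ENNReal.ofReal (w x) ≠ 0 := fun h0 => hl <| nonpos_iff_eq_zero.1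
    ((lintegral_mono_set (ball_subset_ball
      (by linarith [(Nat.cast_nonneg k : (0 : ℝ) ≤ k)]))).trans h0.le)
  have hJ : ∫⁻ x in ball 0 R, ENNReal.ofReal (w x) ^ (-1 / (s - 1)) = ⊤ := by
    refine lintegral_eq_top_of_measure_eq_top_ne_zero (hwm.pow_const _).restrict fun h0 => hk ?_
    refine nonpos_iff_eq_zero.1 (le_trans ?_ h0.le)
    rw [Measure.restrict_apply' measurableSet_ball]
    refine measure_mono (inter_subset_inter (fun x hx => ?_) (ball_subset_ball
      (by linarith [(Nat.cast_nonneg l : (0 : ℝ) ≤ l)])))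
    have hx' : ENNReal.ofReal (w x) = 0 := hx
    change ENNReal.ofReal (w x) ^ (-1 / (s - 1)) = ⊤
    rw [hx', ENNReal.zero_rpow_of_neg]
    rw [neg_div]; exact neg_neg_of_pos (by positivity)
  have hb := (apConst_le_iff (K := apConst s w) hs
    (Filter.Eventually.of_forall fun _ => rfl)).1 le_rfl 0 R hR0
  rw [hJ, ENNReal.top_rpow_of_pos h1, ENNReal.mul_top hI, top_le_iff] at hb
  exact ENNReal.mul_ne_top hw.apConst_lt_top.ne
    (ENNReal.rpow_ne_top_of_nonneg (by linarith) (volume_ball_ne_top 0 R)) hb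

lemma IsApWeight.exists_isMuckenhoupt {w : EuclideanSpace ℝ (Fin n) → ℝ} (hs : 1 < s)
    (hw : IsApWeight s w) (hw0 : ∀ᵐ x, ENNReal.ofReal (w x) ≠ 0) :
    ∃ ϖ, IsMuckenhoupt s (apConst s w) ϖ ∧ ∀ᵐ x, ENNReal.ofReal (w x) = ϖ x := by
  classical
  have hwm : AEMeasurable w := hw.locallyIntegrable.aestronglyMeasurable.aemeasurable
  let g : EuclideanSpace ℝ (Fin n) → ℝ≥0∞ := fun x => ENNReal.ofReal (hwm.mk w x)
  have hg : Measurable g := hwm.measurable_mk.ennreal_ofReal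
  -- The value 1 is a filler on a null set, which makes the representative nonzero at every point.
  let ϖ : EuclideanSpace ℝ (Fin n) → ℝ≥0∞ := fun x => if g x = 0 then 1 else g x
  have hae : ∀ᵐ x, ENNReal.ofReal (w x) = ϖ x := by
    filter_upwards [hwm.ae_eq_mk, hw0] with x hx hx0
    have : g x = ENNReal.ofReal (w x) := by simp only [g, ← hx]
    simp only [ϖ, this, hx0, if_false]
  refine ⟨ϖ, ⟨hs, Measurable.ite (hg (measurableSet_singleton 0)) measurable_const hg,
    fun x => ?_, fun x => ?_, hw.apConst_lt_top.ne, (apConst_le_iff hs hae).1 le_rfl⟩, hae⟩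
  · by_cases hx : g x = 0 <;> simp [ϖ, hx]
  · simp only [ϖ]
    split_ifs
    exacts [ENNReal.one_ne_top, ENNReal.ofReal_ne_top]

end RealWeights

/-! ### Extrapolation from `A_{p₀}` to `A_s`. -/

section Extrapolation

variable {n : ℕ} {s p₀ : ℝ}

lemma lintegral_ne_zero_of_rpow_mul {f ϖ : EuclideanSpace ℝ (Fin n) → ℝ≥0∞} {a : ℝ} (ha : 0 < a)
    (hf : Measurable f) (h : ∫⁻ x, f x ^ a * ϖ x ≠ 0) : ∫⁻ x, f x ≠ 0 := by
  intro h0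
  rw [lintegral_eq_zero_iff hf] at h0
  refine h ?_
  rw [← lintegral_zero (μ := (volume : Measure (EuclideanSpace ℝ (Fin n))))]
  refine lintegral_congr_ae (h0.mono fun x hx => ?_)
  simp only [hx, Pi.zero_apply, ENNReal.zero_rpow_of_pos ha, zero_mul]

lemma ae_ne_top_of_setLIntegral_ball_ne_top {f : EuclideanSpace ℝ (Fin n) → ℝ≥0∞}
    (hf : Measurable f) (h : ∀ x r, ∫⁻ y in ball x r, f y ≠ ⊤) : ∀ᵐ x, f x ≠ ⊤ := by
  rw [← Measure.restrict_univ (μ := volume),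
    ← iUnion_ball_nat (0 : EuclideanSpace ℝ (Fin n)), ae_restrict_iUnion_iff]
  exact fun k => (ae_lt_top hf (h 0 k)).mono fun x hx => hx.ne

/-- The duality bound is tested on the indicator of the ball, whose weighted norm is finite. -/
lemma IsMuckenhoupt.setLIntegral_ball_ne_top_of_le {K : ℝ≥0∞}
    {ϖ : EuclideanSpace ℝ (Fin n) → ℝ≥0∞} (h : IsMuckenhoupt s K ϖ)
    {A : EuclideanSpace ℝ (Fin n) → ℝ≥0∞} {b : ℝ≥0∞} (hb : b ≠ ⊤)
    (hA : ∀ f, Measurable f → ∫⁻ x, A x * f x ≤ 2 * (b * (∫⁻ x, f x ^ s * ϖ x) ^ (1 / s)))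
    (x : EuclideanSpace ℝ (Fin n)) (r : ℝ) : ∫⁻ y in ball x r, A y ≠ ⊤ := by
  have hs := h.one_lt
  rcases le_or_gt r 0 with hr | hr
  · simp [ball_eq_empty.2 hr]
  have := hA ((ball x r).indicator 1) (measurable_one.indicator measurableSet_ball)
  have e1 : ∫⁻ y, A y * (ball x r).indicator 1 y = ∫⁻ y in ball x r, A y := by
    rw [← lintegral_indicator measurableSet_ball]
    refine lintegral_congr fun y => ?_
    by_cases hy : y ∈ ball x r <;> simp [indicator, hy]
  have e2 : ∫⁻ y, (ball x r).indicator 1 y ^ s * ϖ y = ∫⁻ y in ball x r, ϖ y := by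
    rw [← lintegral_indicator measurableSet_ball]
    refine lintegral_congr fun y => ?_
    by_cases hy : y ∈ ball x r
    · simp [indicator, hy]
    · simp only [indicator, hy, if_false]
      rw [ENNReal.zero_rpow_of_pos (by linarith), zero_mul]
  rw [e1, e2] at this
  exact ne_top_of_le_ne_top (ENNReal.mul_ne_top (by simp) (ENNReal.mul_ne_top hb
    (ENNReal.rpow_ne_top_of_nonneg (by positivity) (h.lintegral_ne_top x hr)))) this

/-- Room outside `Ω` for adjusting the weight: it is changed on the first ball and kept on the
second. This is where `1 ≤ n` is needed. -/
lemma exists_disjoint_balls (hn : 1 ≤ n) {Ω : Set (EuclideanSpace ℝ (Fin n))}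
    (hΩ : Bornology.IsBounded Ω) :
    ∃ z y : EuclideanSpace ℝ (Fin n), Disjoint (ball z 1) (ball y 1) ∧ Disjoint Ω (ball z 1) := by
  obtain ⟨R, hR, hΩR⟩ := hΩ.subset_ball_lt 0 (0 : EuclideanSpace ℝ (Fin n))
  let e : EuclideanSpace ℝ (Fin n) := EuclideanSpace.single ⟨0, hn⟩ 1
  have he : ‖e‖ = 1 := by simp [e]
  refine ⟨(R + 1) • e, (R + 3) • e, ball_disjoint_ball ?_, ?_⟩
  · rw [dist_eq_norm, ← sub_smul, norm_smul, he, Real.norm_eq_abs]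
    rw [show R + 1 - (R + 3) = -2 by ring]; norm_num
  · refine Disjoint.mono_left hΩR (ball_disjoint_ball ?_)
    rw [dist_zero_left, norm_smul, he, Real.norm_eq_abs, abs_of_pos (by linarith)]
    linarith

lemma isApWeight_one (hs : 1 < s) :
    IsApWeight s (fun _ : EuclideanSpace ℝ (Fin n) => (1 : ℝ)) := by
  have := (isApWeight_toReal (n := n) (V := fun _ => 1) (K := 1) hs aemeasurable_const
    (fun x r _ => by simpa using volume_ball_ne_top x r) (by simp) (by simp)
    fun x r hr => ?_).1
  · simpa using this
  · simp only [ENNReal.one_rpow, setLIntegral_const, one_mul]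
    conv_lhs => enter [1]; rw [← ENNReal.rpow_one (volume _)]
    rw [← ENNReal.rpow_add _ _ (volume_ball_ne_zero x hr) (volume_ball_ne_top x r)]
    simp

/-- Hölder's inequality against the weight `A^{1-p₀} B`. -/
lemma lintegral_mul_le_factorized {F A B : EuclideanSpace ℝ (Fin n) → ℝ≥0∞} (hp : 1 < p₀)
    (hF : Measurable F) (hA : Measurable A) (hB : Measurable B) (hA0 : ∀ x, A x ≠ 0)
    (hAt : ∀ᵐ x, A x ≠ ⊤) :
    ∫⁻ x, F x * B x ≤ (∫⁻ x, F x ^ p₀ * (A x ^ (1 - p₀) * B x)) ^ (1 / p₀) *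
      (∫⁻ x, B x * A x) ^ (1 / (p₀ / (p₀ - 1))) := by
  have hp1 : 0 < p₀ - 1 := by linarith
  have hp0 : 0 < p₀ := by linarith
  have hc : p₀.HolderConjugate (p₀ / (p₀ - 1)) :=
    (Real.holderConjugate_iff_eq_conjExponent hp).2 rfl
  have hH := ENNReal.lintegral_mul_le_Lp_mul_Lq volume hc
    (f := fun x => F x * (A x ^ (-((p₀ - 1) / p₀)) * B x ^ (1 / p₀)))
    (g := fun x => (B x * A x) ^ ((p₀ - 1) / p₀)) (by fun_prop) (by fun_prop)
  have e0 : ∫⁻ x, F x * B x ≤ ∫⁻ x, ((fun x => F x * (A x ^ (-((p₀ - 1) / p₀)) * B x ^ (1 / p₀))) *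
      (fun x => (B x * A x) ^ ((p₀ - 1) / p₀))) x := by
    refine lintegral_mono_ae (hAt.mono fun x hx => le_of_eq ?_)
    simp only [Pi.mul_apply]
    rw [ENNReal.mul_rpow_of_nonneg _ _ (by positivity)]
    have e1 : A x ^ (-((p₀ - 1) / p₀)) * A x ^ ((p₀ - 1) / p₀) = 1 := by
      rw [← ENNReal.rpow_add _ _ (hA0 x) hx, neg_add_cancel, ENNReal.rpow_zero]
    have e2 : B x ^ (1 / p₀) * B x ^ ((p₀ - 1) / p₀) = B x := by
      rw [← ENNReal.rpow_add_of_nonneg _ _ (by positivity) (by positivity)]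
      conv_rhs => rw [← ENNReal.rpow_one (B x)]
      congr 1; field_simp; ring
    calc F x * B x = F x * ((A x ^ (-((p₀ - 1) / p₀)) * A x ^ ((p₀ - 1) / p₀)) *
          (B x ^ (1 / p₀) * B x ^ ((p₀ - 1) / p₀))) := by rw [e1, e2, one_mul]
      _ = _ := by ring
  refine (e0.trans hH).trans (le_of_eq ?_)
  congr 2
  · refine lintegral_congr_ae (hAt.mono fun x hx => ?_)
    have : A x ^ (-((p₀ - 1) / p₀)) ≠ ⊤ := by simp [ENNReal.rpow_eq_top_iff, hA0 x, hx]
    simp only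
    rw [ENNReal.mul_rpow_of_nonneg _ _ hp0.le, ENNReal.mul_rpow_of_nonneg _ _ hp0.le,
      ← ENNReal.rpow_mul, ← ENNReal.rpow_mul, one_div_mul_cancel hp0.ne', ENNReal.rpow_one]
    congr 3
    field_simp; ring
  · refine lintegral_congr fun x => ?_
    rw [← ENNReal.rpow_mul]
    have : (p₀ - 1) / p₀ * (p₀ / (p₀ - 1)) = 1 := by field_simp
    rw [this, ENNReal.rpow_one]

/-- Rubio de Francia extrapolation for a fixed pair `(F, G)`, under a priori finiteness. The
`A_{p₀}` inequality is needed only for weights whose constant is exactly `(2N₁)^{p₀-1} 2N₂`. -/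
lemma extrapolation_of_finite (hn : 1 ≤ n) {K N₁ N₂ C₀ : ℝ≥0∞} (hp : 1 < p₀)
    {ϖ : EuclideanSpace ℝ (Fin n) → ℝ≥0∞} (h : IsMuckenhoupt s K ϖ)
    (h10 : N₁ ≠ 0) (h1t : N₁ ≠ ⊤) (h20 : N₂ ≠ 0) (h2t : N₂ ≠ ⊤)
    (hN₁ : ∀ f, Measurable f → (∫⁻ x, ballMax volume f x ^ s * ϖ x) ^ (1 / s) ≤
      N₁ * (∫⁻ x, f x ^ s * ϖ x) ^ (1 / s))
    (hN₂ : ∀ f, Measurable f →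
      (∫⁻ x, ballMax volume f x ^ (s / (s - 1)) * ϖ x ^ (-1 / (s - 1))) ^ (1 / (s / (s - 1))) ≤
      N₂ * (∫⁻ x, f x ^ (s / (s - 1)) * ϖ x ^ (-1 / (s - 1))) ^ (1 / (s / (s - 1))))
    {Ω : Set (EuclideanSpace ℝ (Fin n))} (hΩ : Bornology.IsBounded Ω)
    {F G : EuclideanSpace ℝ (Fin n) → ℝ≥0∞} (hF : Measurable F) (hG : Measurable G)
    (hFΩ : ∀ x ∉ Ω, F x = 0) (hGΩ : ∀ x ∉ Ω, G x = 0)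
    (hv : ∀ v : EuclideanSpace ℝ (Fin n) → ℝ, IsApWeight p₀ v →
      apConst p₀ v = (2 * N₁) ^ (p₀ - 1) * (2 * N₂) →
      ∫⁻ x, F x ^ p₀ * ENNReal.ofReal (v x) ≤ C₀ * ∫⁻ x, G x ^ p₀ * ENNReal.ofReal (v x))
    (hFt : ∫⁻ x, F x ^ s * ϖ x ≠ ⊤) (hG0 : ∫⁻ x, G x ^ s * ϖ x ≠ 0)
    (hGt : ∫⁻ x, G x ^ s * ϖ x ≠ ⊤) :
    ∫⁻ x, F x ^ s * ϖ x ≤ (C₀ * 2 + 4) ^ s * ∫⁻ x, G x ^ s * ϖ x := by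
  have hs : 1 < s := h.one_lt
  have h1 : 0 < s - 1 := by linarith
  have hs0 : 0 < s := by linarith
  have hp1 : 0 < p₀ - 1 := by linarith
  set X := ∫⁻ x, F x ^ s * ϖ x with hX
  rcases eq_or_ne X 0 with hX0 | hX0
  · rw [hX0]; exact zero_le
  set t := s / (s - 1) with ht
  have ht0 : 0 < t := by positivity
  have hd := h.dual
  have hϖm := h.measurable
  set σ := fun x => ϖ x ^ (-1 / (s - 1)) with hσ
  let nrm₁ : (EuclideanSpace ℝ (Fin n) → ℝ≥0∞) → ℝ≥0∞ := fun f => (∫⁻ x, f x ^ s * ϖ x) ^ (1 / s)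
  let nrm₂ : (EuclideanSpace ℝ (Fin n) → ℝ≥0∞) → ℝ≥0∞ := fun f => (∫⁻ x, f x ^ t * σ x) ^ (1 / t)
  have hpair : ∀ a b : EuclideanSpace ℝ (Fin n) → ℝ≥0∞, Measurable a → Measurable b →
      ∫⁻ x, a x * b x ≤ nrm₁ a * nrm₂ b := fun a b ha hb => h.lintegral_mul_le volume ha hb
  -- `H` is the function dual to `F`: the pairing of `F` with `H` is `X`, and the dual norm of `H`
  -- is `X ^ (1 / t)`.
  let H : EuclideanSpace ℝ (Fin n) → ℝ≥0∞ := fun x => F x ^ (s - 1) * ϖ x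
  have hHm : Measurable H := (hF.pow_const _).mul hϖm
  have hHX : ∫⁻ x, H x ^ t * σ x = X := by
    refine lintegral_congr fun x => ?_
    simp only [H, hσ]
    rw [ENNReal.mul_rpow_of_nonneg _ _ ht0.le, ← ENNReal.rpow_mul, mul_assoc,
      ← ENNReal.rpow_add _ _ (h.ne_zero x) (h.ne_top x)]
    have e1 : (s - 1) * t = s := by rw [ht]; field_simp
    have e2 : t + -1 / (s - 1) = 1 := by rw [ht]; field_simp; ring
    rw [e1, e2, ENNReal.rpow_one]
  set A := rubioDeFrancia N₁ G with hA
  set B := rubioDeFrancia N₂ H with hB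
  have hAm : Measurable A := measurable_rubioDeFrancia hG
  have hBm : Measurable B := measurable_rubioDeFrancia hHm
  have hA2 : ∀ b, Measurable b → ∫⁻ x, A x * b x ≤ 2 * (nrm₁ G * nrm₂ b) := fun b hb =>
    lintegral_rubioDeFrancia_mul_le hG h10 h1t hb nrm₁ _ hN₁ fun f hf => hpair f b hf hb
  have hB2 : ∀ a, Measurable a → ∫⁻ x, B x * a x ≤ 2 * (nrm₂ H * nrm₁ a) := fun a ha =>
    lintegral_rubioDeFrancia_mul_le hHm h20 h2t ha nrm₂ _ hN₂ fun f hf => by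
      simp_rw [mul_comm (f _)]; rw [mul_comm]; exact hpair a f ha hf
  -- The pairing bound is used for both series, which yields the factor 4.
  have hBA : ∫⁻ x, B x * A x ≤ 2 * (nrm₂ H * (2 * nrm₁ G)) :=
    lintegral_rubioDeFrancia_mul_le hHm h20 h2t hAm nrm₂ _ hN₂ fun f hf => by
      simp_rw [mul_comm (f _)]
      exact (hA2 f hf).trans (le_of_eq (by ring))
  have hgt : nrm₁ G ≠ ⊤ := ENNReal.rpow_ne_top_of_nonneg (by positivity) hGt
  have hyt : nrm₂ H ≠ ⊤ := ENNReal.rpow_ne_top_of_nonneg (by positivity) (by rw [hHX]; exact hFt)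
  have hAloc : ∀ x r, ∫⁻ y in ball x r, A y ≠ ⊤ := hd.setLIntegral_ball_ne_top_of_le hgt hA2
  have hBloc : ∀ x r, ∫⁻ y in ball x r, B y ≠ ⊤ := h.setLIntegral_ball_ne_top_of_le hyt hB2
  have hA0 : ∀ x, A x ≠ 0 :=
    rubioDeFrancia_ne_zero hG h10 h1t (lintegral_ne_zero_of_rpow_mul hs0 hG hG0)
  have hB0 : ∀ x, B x ≠ 0 := rubioDeFrancia_ne_zero hHm h20 h2t
    (lintegral_ne_zero_of_rpow_mul ht0 hHm (by rw [hHX]; exact hX0))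
  have hAfin : ∀ᵐ x, A x ≠ ⊤ := ae_ne_top_of_setLIntegral_ball_ne_top hAm hAloc
  have hBfin : ∀ᵐ x, B x ≠ ⊤ := ae_ne_top_of_setLIntegral_ball_ne_top hBm hBloc
  set V : EuclideanSpace ℝ (Fin n) → ℝ≥0∞ := fun x => A x ^ (1 - p₀) * B x with hV
  have hVm : Measurable V := (hAm.pow_const _).mul hBm
  have hfac := bound_of_factorization (a := 2 * N₁) (b := 2 * N₂) hp hAm hBm (by simp [h10])
    (ENNReal.mul_ne_top (by simp) h1t) (by simp [h20]) (ENNReal.mul_ne_top (by simp) h2t)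
    hA0 hB0 hAloc hBloc
    (fun x y r hx => setLIntegral_div_le_rubioDeFrancia hG h10 h1t hx)
    (fun x y r hx => setLIntegral_div_le_rubioDeFrancia hHm h20 h2t hx)
  set κ := (2 * N₁) ^ (p₀ - 1) * (2 * N₂) with hκ
  have hκt : κ ≠ ⊤ := ENNReal.mul_ne_top (ENNReal.rpow_ne_top_of_nonneg hp1.le
    (ENNReal.mul_ne_top (by simp) h1t)) (ENNReal.mul_ne_top (by simp) h2t)
  have hVt : ∀ᵐ x, V x ≠ ⊤ := by
    filter_upwards [hAfin, hBfin] with x hx1 hx2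
    exact ENNReal.mul_ne_top (by simp [ENNReal.rpow_eq_top_iff, hA0 x, hx1]) hx2
  have hV0 : ∀ᵐ x, (V x).toReal ≠ 0 := by
    filter_upwards [hAfin, hVt] with x hx1 hx2
    refine ENNReal.toReal_ne_zero.2 ⟨mul_ne_zero ?_ (hB0 x), hx2⟩
    simp [ENNReal.rpow_eq_zero_iff, hA0 x, hx1]
  obtain ⟨hVw, hVκ⟩ := isApWeight_toReal hp hVm.aemeasurable (fun x r hr => (hfac x r hr).1) hVt hκt
    (fun x r hr => (hfac x r hr).2)
  obtain ⟨z, y, hzy, hΩz⟩ := exists_disjoint_balls hn hΩ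
  obtain ⟨v, hvw, hvκ, hvV⟩ := exists_isApWeight_apConst_eq hp hVw hV0 hκt hVκ hzy
  -- `v` has constant exactly `κ` and differs from `V` only outside `Ω`, up to a null set, so it may
  -- be replaced by `V` in both integrals.
  have hrepl : ∀ f : EuclideanSpace ℝ (Fin n) → ℝ≥0∞, (∀ x ∉ Ω, f x = 0) →
      ∫⁻ x, f x ^ p₀ * ENNReal.ofReal (v x) = ∫⁻ x, f x ^ p₀ * V x := by
    intro f hf
    refine lintegral_congr_ae (hVt.mono fun x hx => ?_)
    by_cases hxΩ : x ∈ Ω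
    · simp only
      rw [hvV x (disjoint_left.1 hΩz hxΩ), ENNReal.ofReal_toReal hx]
    · simp only [hf x hxΩ, ENNReal.zero_rpow_of_pos (by linarith : 0 < p₀), zero_mul]
  have hI := hv v hvw hvκ
  rw [hrepl F hFΩ, hrepl G hGΩ] at hI
  have hGV : ∫⁻ x, G x ^ p₀ * V x ≤ ∫⁻ x, B x * G x := by
    refine lintegral_mono_ae (hAfin.mono fun x hx => ?_)
    have e1 : G x ^ p₀ = G x * G x ^ (p₀ - 1) := by
      conv_rhs => enter [1]; rw [← ENNReal.rpow_one (G x)]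
      rw [← ENNReal.rpow_add_of_nonneg _ _ zero_le_one hp1.le]
      congr 1; ring
    have e2 : A x ^ (p₀ - 1) * A x ^ (1 - p₀) = 1 := by
      rw [← ENNReal.rpow_add _ _ (hA0 x) hx]
      simp
    calc G x ^ p₀ * V x ≤ G x * A x ^ (p₀ - 1) * V x := by
          rw [e1]
          gcongr
          exact le_rubioDeFrancia x
      _ = A x ^ (p₀ - 1) * A x ^ (1 - p₀) * (B x * G x) := by simp only [hV]; ring
      _ = B x * G x := by rw [e2, one_mul]
  have hXFB : X ≤ ∫⁻ x, F x * B x := by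
    refine lintegral_mono fun x => ?_
    have e1 : F x ^ s = F x * F x ^ (s - 1) := by
      conv_rhs => enter [1]; rw [← ENNReal.rpow_one (F x)]
      rw [← ENNReal.rpow_add_of_nonneg _ _ zero_le_one h1.le]
      congr 1; ring
    calc F x ^ s * ϖ x = F x * H x := by rw [e1, mul_assoc]
      _ ≤ F x * B x := by gcongr; exact le_rubioDeFrancia x
  set Z := nrm₂ H * nrm₁ G with hZ
  -- Both Hölder factors are bounded by powers of the same quantity, with exponents summing to 1;
  -- `C₀ * 2 + 4` dominates the two constants `C₀ * 2` and `4`.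
  have hXZ : X ≤ (C₀ * 2 + 4) * Z := by
    calc X ≤ (∫⁻ x, F x ^ p₀ * V x) ^ (1 / p₀) * (∫⁻ x, B x * A x) ^ (1 / (p₀ / (p₀ - 1))) :=
          hXFB.trans (lintegral_mul_le_factorized hp hF hAm hBm hA0 hAfin)
      _ ≤ ((C₀ * 2 + 4) * Z) ^ (1 / p₀) * ((C₀ * 2 + 4) * Z) ^ (1 / (p₀ / (p₀ - 1))) := by
          gcongr
          · calc _ ≤ C₀ * (2 * Z) := hI.trans (mul_le_mul_right (hGV.trans (hB2 G hG)) _)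
              _ = C₀ * 2 * Z := by ring
              _ ≤ _ := by gcongr; exact le_self_add
          · calc _ ≤ 4 * Z := hBA.trans (le_of_eq (by rw [hZ]; ring))
              _ ≤ _ := by gcongr; exact le_add_self
      _ = (C₀ * 2 + 4) * Z := by
          rw [← ENNReal.rpow_add_of_nonneg _ _ (by positivity) (by positivity)]
          have : 1 / p₀ + 1 / (p₀ / (p₀ - 1)) = 1 := by field_simp; ring
          rw [this, ENNReal.rpow_one]
  have hXt : nrm₂ H = X ^ (1 / t) := by simp only [nrm₂, hHX]
  have hXsplit : X = X ^ (1 / t) * X ^ (1 / s) := by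
    rw [← ENNReal.rpow_add _ _ hX0 hFt]
    have : 1 / t + 1 / s = 1 := by rw [ht]; field_simp; ring
    rw [this, ENNReal.rpow_one]
  have hXs0 : X ^ (1 / t) ≠ 0 := by simp [ENNReal.rpow_eq_zero_iff, hX0, hFt]
  have hXst : X ^ (1 / t) ≠ ⊤ := ENNReal.rpow_ne_top_of_nonneg (by positivity) hFt
  -- Here `X ^ (1 / t)` is cancelled, which requires `X` to be finite and nonzero.
  have hfinal : X ^ (1 / s) ≤ (C₀ * 2 + 4) * nrm₁ G := by
    rw [← ENNReal.mul_le_mul_iff_right hXs0 hXst, ← hXsplit]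
    refine hXZ.trans (le_of_eq ?_)
    rw [hZ, hXt]; ring
  have := ENNReal.rpow_le_rpow hfinal hs0.le
  rw [← ENNReal.rpow_mul, one_div_mul_cancel hs0.ne', ENNReal.rpow_one,
    ENNReal.mul_rpow_of_nonneg _ _ hs0.le] at this
  refine this.trans (le_of_eq ?_)
  simp only [nrm₁]
  rw [← ENNReal.rpow_mul, one_div_mul_cancel hs0.ne', ENNReal.rpow_one]

/-- Rubio de Francia extrapolation from `A_{p₀}` to `A_s` for pairs supported in a bounded set. -/
theorem extrapolation (hn : 1 ≤ n) (hp : 1 < p₀) (C : ℝ → ℝ) {K : ℝ≥0∞} (hK : K ≠ ⊤) :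
    ∃ c : ℝ≥0∞, c ≠ 0 ∧ c ≠ ⊤ ∧ ∀ ϖ : EuclideanSpace ℝ (Fin n) → ℝ≥0∞, IsMuckenhoupt s K ϖ →
      ∀ Ω : Set (EuclideanSpace ℝ (Fin n)), Bornology.IsBounded Ω →
      ∀ F G : EuclideanSpace ℝ (Fin n) → ℝ≥0∞, Measurable F → Measurable G →
      (∀ x, F x ≠ ⊤) → (∀ x ∉ Ω, F x = 0) → (∀ x ∉ Ω, G x = 0) →
      (∀ v : EuclideanSpace ℝ (Fin n) → ℝ, IsApWeight p₀ v →
        ∫⁻ x, F x ^ p₀ * ENNReal.ofReal (v x) ≤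
          ENNReal.ofReal (C (apConst p₀ v).toReal) * ∫⁻ x, G x ^ p₀ * ENNReal.ofReal (v x)) →
      ∫⁻ x, F x ^ s * ϖ x ≤ c * ∫⁻ x, G x ^ s * ϖ x := by
  by_cases hs : 1 < s
  swap
  · exact ⟨1, one_ne_zero, ENNReal.one_ne_top, fun ϖ h => absurd h.one_lt hs⟩
  have hs0 : 0 < s := by linarith
  have hp0 : 0 < p₀ := by linarith
  have hK' : K ^ (1 / (s - 1)) ≠ ⊤ :=
    ENNReal.rpow_ne_top_of_nonneg (one_div_nonneg.2 (by linarith)) hK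
  obtain ⟨N₁, h10, h1t, hN₁⟩ := exists_ballMax_bound n s hK
  obtain ⟨N₂, h20, h2t, hN₂⟩ := exists_ballMax_bound n (s / (s - 1)) hK'
  set κ := (2 * N₁) ^ (p₀ - 1) * (2 * N₂) with hκ
  set C₀ := ENNReal.ofReal (C κ.toReal) with hC₀
  have hct : C₀ * 2 + 4 ≠ ⊤ := by
    simp only [Ne, ENNReal.add_eq_top, not_or]
    exact ⟨ENNReal.mul_ne_top ENNReal.ofReal_ne_top (by simp), by simp⟩
  have hc0 : (C₀ * 2 + 4) ^ s ≠ 0 := by simp [ENNReal.rpow_eq_zero_iff, hct]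
  refine ⟨(C₀ * 2 + 4) ^ s, hc0, ENNReal.rpow_ne_top_of_nonneg hs0.le hct, ?_⟩
  intro ϖ h Ω hΩ F G hF hG hFt hFΩ hGΩ hv
  have hϖm := h.measurable
  rcases eq_or_ne (∫⁻ x, G x ^ s * ϖ x) ⊤ with hGt | hGt
  · rw [hGt, ENNReal.mul_top hc0]; exact le_top
  rcases eq_or_ne (∫⁻ x, G x ^ s * ϖ x) 0 with hG0 | hG0
  -- If `G` vanishes, its series is not a positive weight. The estimate with `v = 1` then shows
  -- directly that `F` vanishes almost everywhere.
  · have hGae : ∀ᵐ x, G x = 0 := by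
      rw [lintegral_eq_zero_iff (f := fun x => G x ^ s * ϖ x) ((hG.pow_const _).mul hϖm)] at hG0
      refine hG0.mono fun x hx => ?_
      have : G x ^ s = 0 := (mul_eq_zero.1 hx).resolve_right (h.ne_zero x)
      exact (ENNReal.rpow_eq_zero_iff_of_pos hs0).1 this
    have h1 := hv _ (isApWeight_one hp)
    have e1 : ∫⁻ x, G x ^ p₀ * ENNReal.ofReal 1 = 0 := by
      rw [← lintegral_zero (μ := (volume : Measure (EuclideanSpace ℝ (Fin n))))]
      refine lintegral_congr_ae (hGae.mono fun x hx => ?_)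
      simp only [hx, ENNReal.zero_rpow_of_pos hp0, zero_mul]
    rw [e1, mul_zero, nonpos_iff_eq_zero,
      lintegral_eq_zero_iff (f := fun x => F x ^ p₀ * ENNReal.ofReal 1)
        ((hF.pow_const _).mul measurable_const)] at h1
    refine le_trans (le_of_eq ?_) zero_le
    rw [← lintegral_zero (μ := (volume : Measure (EuclideanSpace ℝ (Fin n))))]
    refine lintegral_congr_ae (h1.mono fun x hx => ?_)
    have hx' : F x ^ p₀ = 0 := by simpa using hx
    simp only [(ENNReal.rpow_eq_zero_iff_of_pos hp0).1 hx', ENNReal.zero_rpow_of_pos hs0, zero_mul]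
  obtain ⟨R, hR0, hΩR⟩ := hΩ.subset_ball_lt 0 (0 : EuclideanSpace ℝ (Fin n))
  -- The truncation is bounded with bounded support, so its weighted norm is finite, and it inherits
  -- the assumed estimate from `F`. Monotone convergence removes it.
  have hk : ∀ k : ℕ, ∫⁻ x, min (F x) k ^ s * ϖ x ≤
      (C₀ * 2 + 4) ^ s * ∫⁻ x, G x ^ s * ϖ x := by
    intro k
    refine extrapolation_of_finite hn hp h h10 h1t h20 h2t (hN₁ ϖ h) (hN₂ _ h.dual) hΩ
      (hF.min measurable_const) hG (fun x hx => by simp [hFΩ x hx]) hGΩ (fun v hvw hvκ => ?_) ?_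
      hG0 hGt
    · have := hv v hvw
      rw [hvκ] at this
      refine le_trans (lintegral_mono fun x => ?_) this
      gcongr
      exact min_le_left _ _
    · have hle : ∫⁻ x, min (F x) k ^ s * ϖ x ≤ (k : ℝ≥0∞) ^ s * ∫⁻ x in ball 0 R, ϖ x := by
        rw [← lintegral_const_mul _ hϖm, ← lintegral_indicator measurableSet_ball]
        refine lintegral_mono fun x => ?_
        by_cases hx : x ∈ ball (0 : EuclideanSpace ℝ (Fin n)) R
        · simp only [indicator, hx, if_true]
          gcongr
          exact min_le_right _ _
        · have : F x = 0 := hFΩ x fun hx' => hx (hΩR hx')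
          simp only [this, zero_le, min_eq_left, ENNReal.zero_rpow_of_pos hs0, zero_mul]
      exact ne_top_of_le_ne_top (ENNReal.mul_ne_top
        (ENNReal.rpow_ne_top_of_nonneg hs0.le (by simp)) (h.lintegral_ne_top 0 hR0)) hle
  calc ∫⁻ x, F x ^ s * ϖ x ≤ ∫⁻ x, ⨆ k : ℕ, min (F x) k ^ s * ϖ x := by
        refine lintegral_mono fun x => ?_
        obtain ⟨k, hk⟩ := ENNReal.exists_nat_gt (hFt x)
        exact le_iSup_of_le k (by rw [min_eq_left hk.le])
    _ = ⨆ k : ℕ, ∫⁻ x, min (F x) k ^ s * ϖ x := by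
        refine lintegral_iSup (fun k => ((hF.min measurable_const).pow_const _).mul hϖm) ?_
        intro k l hkl x
        simp only
        gcongr
    _ ≤ _ := iSup_le hk

end Extrapolation

/-! ### Application to the gradient and the datum. -/

lemma lintegral_indicator_enorm_rpow {n : ℕ} {Ω : Set (EuclideanSpace ℝ (Fin n))}
    (hΩ : MeasurableSet Ω) {f g : EuclideanSpace ℝ (Fin n) → EuclideanSpace ℝ (Fin n)}
    (hfg : f =ᵐ[volume.restrict Ω] g) {a b c : ℝ} (hb : 0 < b) (habc : a * b = c)
    (w : EuclideanSpace ℝ (Fin n) → ℝ≥0∞) :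
    ∫⁻ x, Ω.indicator (fun x => ‖g x‖ₑ ^ a) x ^ b * w x = ∫⁻ x in Ω, ‖f x‖ₑ ^ c * w x := by
  have : ∫⁻ x in Ω, ‖f x‖ₑ ^ c * w x = ∫⁻ x in Ω, ‖g x‖ₑ ^ c * w x :=
    lintegral_congr_ae (hfg.mono fun x hx => by simp only [hx])
  rw [this, ← lintegral_indicator hΩ]
  refine lintegral_congr fun x => ?_
  by_cases hx : x ∈ Ω
  · simp only [indicator, hx, if_true]
    rw [← ENNReal.rpow_mul, habc]
  · simp only [indicator, hx, if_false]
    rw [ENNReal.zero_rpow_of_pos hb, zero_mul]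

theorem mainTheorem4 (n : ℕ) (hn : 1 ≤ n) (p q : ℝ) (hp : 1 < p) (hq : p - 1 < q)
    (C : ℝ → ℝ) (hC : ∀ t, 0 < C t) :
    ∃ C' : ℝ → ℝ, (∀ t, 0 < C' t) ∧
      ∀ (Λ₀ Λ₁ : ℝ)
        (A : EuclideanSpace ℝ (Fin n) → EuclideanSpace ℝ (Fin n) → EuclideanSpace ℝ (Fin n))
        (_ : IsPLaplaceType p Λ₀ Λ₁ A)
        (Ω : Set (EuclideanSpace ℝ (Fin n)))
        (_ : IsOpen Ω) (_ : IsConnected Ω) (_ : Bornology.IsBounded Ω)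
        (f : EuclideanSpace ℝ (Fin n) → EuclideanSpace ℝ (Fin n))
        (_ : MemLp f (ENNReal.ofReal p) (volume.restrict Ω))
        (u : EuclideanSpace ℝ (Fin n) → ℝ)
        (gradu : EuclideanSpace ℝ (Fin n) → EuclideanSpace ℝ (Fin n))
        (_ : IsWeakSolution p Ω A f u gradu),
        (∀ v : EuclideanSpace ℝ (Fin n) → ℝ, IsApWeight (p / (p - 1)) v →
          ∫⁻ x in Ω, ‖gradu x‖ₑ ^ p * ENNReal.ofReal (v x) ≤
            ENNReal.ofReal (C (apConst (p / (p - 1)) v).toReal) *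
              ∫⁻ x in Ω, ‖f x‖ₑ ^ p * ENNReal.ofReal (v x)) →
        ∀ w : EuclideanSpace ℝ (Fin n) → ℝ, IsApWeight (q / (p - 1)) w →
          ∫⁻ x in Ω, ‖gradu x‖ₑ ^ q * ENNReal.ofReal (w x) ≤
            ENNReal.ofReal (C' (apConst (q / (p - 1)) w).toReal) *
              ∫⁻ x in Ω, ‖f x‖ₑ ^ q * ENNReal.ofReal (w x) := by
  have hp1 : 0 < p - 1 := by linarith
  have hp₀ : 1 < p / (p - 1) := by rw [lt_div_iff₀ hp1]; linarith
  have hs : 1 < q / (p - 1) := by rw [lt_div_iff₀ hp1]; linarith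
  -- The constant is chosen as a function of the `A_s` constant alone, before any domain, datum or
  -- weight is fixed.
  choose c hc0 hct hc using fun t : ℝ =>
    extrapolation (n := n) (s := q / (p - 1)) hn hp₀ C (K := ENNReal.ofReal t) ENNReal.ofReal_ne_top
  refine ⟨fun t => (c t).toReal, fun t => ENNReal.toReal_pos (hc0 t) (hct t), ?_⟩
  intro Λ₀ Λ₁ A _ Ω hΩo _ hΩb f hf u gradu hu hv w hw
  have hΩm := hΩo.measurableSet
  -- A weight that is zero almost everywhere makes the left side vanish; any other has a positive
  -- representative.
  rcases hw.ae_eq_zero_or_ae_ne_zero hs with hw0 | hw0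
  · refine le_trans (le_of_eq ?_) zero_le
    rw [← lintegral_zero (μ := volume.restrict Ω)]
    refine lintegral_congr_ae ((ae_restrict_of_ae hw0).mono fun x hx => ?_)
    simp only [hx, mul_zero]
  obtain ⟨ϖ, hϖ, hwϖ⟩ := hw.exists_isMuckenhoupt hs hw0
  have hK : ENNReal.ofReal (apConst (q / (p - 1)) w).toReal = apConst (q / (p - 1)) w :=
    ENNReal.ofReal_toReal hw.apConst_lt_top.ne
  rw [← hK] at hϖ
  have hgm := hu.mem.memLp_grad.aestronglyMeasurable
  have hfm := hf.aestronglyMeasurable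
  have hpe : (p - 1) * (p / (p - 1)) = p := by field_simp
  have hqe : (p - 1) * (q / (p - 1)) = q := by field_simp
  -- Raising the norms to the power `p - 1` turns the exponents `p/(p-1)` and `q/(p-1)` back into
  -- `p` and `q`.
  have key := hc _ ϖ hϖ Ω hΩb (Ω.indicator fun x => ‖hgm.mk gradu x‖ₑ ^ (p - 1))
    (Ω.indicator fun x => ‖hfm.mk f x‖ₑ ^ (p - 1))
    ((hgm.stronglyMeasurable_mk.enorm.pow_const _).indicator hΩm)
    ((hfm.stronglyMeasurable_mk.enorm.pow_const _).indicator hΩm)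
    (fun x => ?_) (fun x hx => indicator_of_notMem hx _) (fun x hx => indicator_of_notMem hx _)
    (fun v hvw => ?_)
  · rw [lintegral_indicator_enorm_rpow hΩm hgm.ae_eq_mk (by linarith) hqe,
      lintegral_indicator_enorm_rpow hΩm hfm.ae_eq_mk (by linarith) hqe] at key
    have hcongr : ∀ g : EuclideanSpace ℝ (Fin n) → EuclideanSpace ℝ (Fin n),
        ∫⁻ x in Ω, ‖g x‖ₑ ^ q * ENNReal.ofReal (w x) = ∫⁻ x in Ω, ‖g x‖ₑ ^ q * ϖ x := fun g =>
      lintegral_congr_ae ((ae_restrict_of_ae hwϖ).mono fun x hx => by simp only [hx])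
    rw [hcongr, hcongr, ENNReal.ofReal_toReal (hct _)]
    exact key
  · by_cases hx : x ∈ Ω
    · simp only [indicator, hx, if_true]
      exact ENNReal.rpow_ne_top_of_nonneg hp1.le enorm_ne_top
    · simp [indicator, hx]
  · rw [lintegral_indicator_enorm_rpow hΩm hgm.ae_eq_mk (by linarith) hpe,
      lintegral_indicator_enorm_rpow hΩm hfm.ae_eq_mk (by linarith) hpe]
    exact hv v hvw
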